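/- **Multiscale CSPAT decomposition.** Let $d\ge 1$ and let $S\subseteq\mathbb R^d$ be non-empty. For $f\in C^\infty(\mathbb R^d)$ let $p$ be the classical solution of $p_{tt}-\Delta p=0$ on $\mathbb R^d\times(0,\infty)$ with $p(\cdot,0)=f$, $p_t(\cdot,0)=0$, and put $\mathbf W f:=p|_{S\times(0,\infty)}$. Write $\circledast_x$ (also $\ast$) for convolution on $\mathbb R^d$ and $v\circledast_t g$ for convolution in the time variable, where data $g$ given for $t>0$ are extended evenly to $t<0$. A family $(u_j)_{j\in\mathbb N}$ of real functions in $L^1(\mathbb R^d)\cap L^2(\mathbb R^d)$ is a *convolutional frame* if there are $A,B>0$ with $A\|h\|_2^2\le\sum_j\|u_j\circledast_x h\|_2^2\le B\|h\|_2^2$ for all $h\in L^2(\mathbb R^d)$; it is a *multiscale decomposition* if moreover $u_j(x)=2^{jd}\psi(2^jx)$ for all $j\ge1$ with some $\psi\in L^1\cap L^2$. The pair $(\mathbf u,\mathbf v)$ is a *multiscale factorization of $\mathbf W$* if $\mathbf u=(u_j)_{j\in\mathbb N}$ and $\mathbf v=(v_j)_{j\in\mathbb N}$ are multiscale decompositions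 in $L^2(\mathbb R^d)$ and $L^2(\mathbb R)$, respectively, and $\mathbf W(u_j\circledast_x f)=v_j\circledast_t(\mathbf W f)$ on $S\times(0,\infty)$ for all $j$ and all $f\in C_c^\infty(\mathbb R^d)$. For an even function $v$ define $$\mathbf R^\sharp v(x)=\begin{cases}\dfrac{(-1)^{(d-1)/2}}{\sqrt{\pi^{d-1}}}\Bigl(\bigl(\tfrac1{2t}\tfrac{\partial}{\partial t}\bigr)^{(d-1)/2}v\Bigr)(\|x\|), & d\text{ odd},\\[2ex] \dfrac{2(-1)^{d/2}}{\sqrt{\pi^{d}}}\displaystyle\int_{\|x\|}^\infty\frac{\bigl(\tfrac1{2t}\tfrac{\partial}{\partial t}\bigr)^{d/2}v(t)}{\sqrt{t^2-\|x\|^2}}\,t\,\mathrm dt, & d\text{ even}.\end{cases}$$ Let $(\mathbf u,\mathbf v)$ be a multiscale factorization of $\mathbf W$ such that, with $k=\lceil (d-1)/2\rceil$, every $v_j$ is even, $k$ times continuously differentiable on $(0,\infty)$, and decays so that $\int_0^\infty t^{2k}\bigl|\bigl(\tfrac1{2t}\tfrac{\partial}{\partial t}\bigr)^k v_j(t)\bigr|\,\mathrm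 dt<\infty$. Then $\sum_{j}|\mathbf F_du_j|^2\in L^\infty(\mathbb R^d)$, so that $\Phi:=\mathbf F_d^{-1}\bigl(\sum_{j}|\mathbf F_du_j|^2\bigr)$ is a tempered distribution, and for every $f\in C_c^\infty(\mathbb R^d)$ the factors $f_j:=u_j\circledast_x f$ satisfy the following. 1. All convolutions $(\mathbf R^\sharp v_j)\ast f_j$ exist as absolutely convergent integrals at every point, $\Phi\circledast_x f$ and all $(\mathbf R^\sharp v_j)\ast f_j$ lie in $L^2(\mathbb R^d)$, and $$\Phi\circledast_x f=\sum_{j\in\mathbb N}(\mathbf R^\sharp v_j)\ast f_j$$ with unconditional convergence in $L^2(\mathbb R^d)$. 2. For all $m,n\in\mathbb N$, sampling points $z_1,\dots,z_n\in S$ and matrices $\mathbf A_{m,n}\in\mathbb R^{m\times n}$, with $\mathbf W_nf:=(\mathbf Wf(z_\ell,\cdot))_{\ell=1,\dots,n}$, and for every $j\in\mathbb N$ and $t>0$, $$\bigl((\mathbf A_{m,n}\mathbf W_n)f_j\bigr)(t)=\bigl(v_j\circledast_t(\mathbf A_{m,n}\mathbf W_nf)\bigr)(t)$$ componentwise, where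 the integrals defining the right hand side converge absolutely. -/

import Mathlib

open MeasureTheory Set Filter Topology
open scoped ENNReal FourierTransform SchwartzMap ContDiff Convolution Laplacian

noncomputable section

namespace CSPAT

/-- The Euclidean space `ℝ^d`. -/
abbrev E (d : ℕ) : Type := EuclideanSpace ℝ (Fin d)

/-! ### Convolutional frames and multiscale decompositions

The group `G` below is `ℝ^d` (spatial filters) or `ℝ` (temporal filters). -/

/-- Convolution of real-valued functions, `(u ⊛ f)(x) = ∫ u(y) f(x - y) dy`. -/
def conv {G : Type*} [AddGroup G] [MeasureSpace G] (u f : G → ℝ) : G → ℝ :=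
  u ⋆[ContinuousLinearMap.mul ℝ ℝ, volume] f

/-- A convolutional frame: a family in `L¹ ∩ L²` such that, for some `A, B > 0`,
`A ‖f‖² ≤ ∑_λ ‖u_λ ⊛ f‖² ≤ B ‖f‖²` for all `f ∈ L²`. The sum is taken in `[0, ∞]`. -/
structure IsConvFrame {ι G : Type*} [NormedAddCommGroup G] [MeasureSpace G]
    (u : ι → G → ℝ) : Prop where
  memLp_one : ∀ l, MemLp (u l) 1 volume
  memLp_two : ∀ l, MemLp (u l) 2 volume
  bounds : ∃ A B : ℝ, 0 < A ∧ 0 < B ∧ ∀ f : G → ℝ, MemLp f 2 volume →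
    ENNReal.ofReal A * eLpNorm f 2 volume ^ 2 ≤ ∑' l, eLpNorm (conv (u l) f) 2 volume ^ 2 ∧
    ∑' l, eLpNorm (conv (u l) f) 2 volume ^ 2 ≤ ENNReal.ofReal B * eLpNorm f 2 volume ^ 2

/-- A multiscale convolution decomposition: a convolutional frame `(u_j)_{j ∈ ℕ}` for which there
is `ψ ∈ L¹ ∩ L²` with `u_j(x) = 2^{jd} ψ(2^j x)` for all `j ≥ 1`, `d` the dimension of the space.
The low-frequency filter `u_0` is not tied to `ψ`. -/
structure IsMultiscale {G : Type*} [NormedAddCommGroup G] [NormedSpace ℝ G] [MeasureSpace G]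
    (u : ℕ → G → ℝ) : Prop where
  frame : IsConvFrame u
  scaling : ∃ ψ : G → ℝ, MemLp ψ 1 volume ∧ MemLp ψ 2 volume ∧
    ∀ j, 1 ≤ j → ∀ x, u j x = 2 ^ (j * Module.finrank ℝ G) * ψ ((2 : ℝ) ^ j • x)

/-! ### The wave equation and the forward operators -/

/-- `p` is the classical solution of `p_tt - Δp = 0` on `ℝ^d × (0, ∞)` with `p(·, 0) = f` and
`p_t(·, 0) = 0`. Only the values `p x t` with `t ≥ 0` are constrained. -/
structure IsWaveSolution {d : ℕ} (f : E d → ℝ) (p : E d → ℝ → ℝ) : Prop where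
  contDiffOn : ContDiffOn ℝ 2 (fun q : E d × ℝ => p q.1 q.2) (univ ×ˢ Ici 0)
  wave : ∀ x t, 0 < t → iteratedDeriv 2 (p x) t - Δ (fun y => p y t) x = 0
  initial : ∀ x, p x 0 = f x
  initial_deriv : ∀ x, HasDerivWithinAt (p x) 0 (Ici 0) 0

open Classical in
/-- The acoustic pressure with initial pressure `f`: the classical solution of the initial value
problem, which is unique on `t ≥ 0` when it exists (and `0` if there is none). -/
def pressure {d : ℕ} (f : E d → ℝ) : E d → ℝ → ℝ :=
  if h : ∃ p, IsWaveSolution f p then h.choose else 0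

/-- The continuous forward operator `W f = p|_{S × (0, ∞)}`. As a function of time it is only
meaningful for `t > 0`, and only used there. -/
def W {d : ℕ} (S : Set (E d)) (f : E d → ℝ) : S → ℝ → ℝ :=
  fun z t => pressure f z t

/-- The sampling scheme `S_n g = (g(z_l, ·))_l`. -/
def sample {d n : ℕ} {S : Set (E d)} (z : Fin n → S) (g : S → ℝ → ℝ) : Fin n → ℝ → ℝ :=
  fun l t => g (z l) t

/-- The compressed sensing forward operator `A_{m,n} W_n = A_{m,n} S_n W`; the matrix acts on the
index of the sampling points, for every fixed time. -/
def csForward {d m n : ℕ} {S : Set (E d)} (A : Matrix (Fin m) (Fin n) ℝ) (z : Fin n → S)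
    (f : E d → ℝ) : Fin m → ℝ → ℝ :=
  fun i t => (A.mulVec fun l => sample z (W S f) l t) i

/-- Even extension in time of a function given on `(0, ∞)`. -/
def evenExt (g : ℝ → ℝ) : ℝ → ℝ := fun t => g |t|

/-- Temporal convolution `v ⊛_t g` of a filter with data recorded on `(0, ∞)`. The data are
extended evenly in time, as solutions of the wave equation with `p_t(·, 0) = 0` are. -/
def timeConv (v g : ℝ → ℝ) : ℝ → ℝ := conv v (evenExt g)

/-! ### Factorizations of the wave equation -/

/-- A convolution factorization `(u, v)` of `W`. -/
structure IsConvFactorization {ι : Type*} {d : ℕ} (S : Set (E d)) (u : ι → E d → ℝ)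
    (v : ι → ℝ → ℝ) : Prop where
  frame_left : IsConvFrame u
  frame_right : IsConvFrame v
  commute : ∀ l, ∀ f : E d → ℝ, ContDiff ℝ ∞ f → HasCompactSupport f →
    ∀ z : S, ∀ t, 0 < t → W S (conv (u l) f) z t = timeConv (v l) (W S f z) t

/-- A multiscale factorization `(u, v)` of `W`. -/
structure IsMultiscaleFactorization {d : ℕ} (S : Set (E d)) (u : ℕ → E d → ℝ)
    (v : ℕ → ℝ → ℝ) : Prop where
  factorization : IsConvFactorization S u v
  multiscale_left : IsMultiscale u
  multiscale_right : IsMultiscale v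

/-! ### The operator `R^♯` -/

/-- The differential operator `(1 / (2t)) ∂/∂t`. -/
def radialDeriv (g : ℝ → ℝ) : ℝ → ℝ := fun t => 1 / (2 * t) * deriv g t

/-- The radial function `R^♯ v` on `ℝ^d` whose Radon transform is the even function `v`. -/
def radonSharp (d : ℕ) (v : ℝ → ℝ) : E d → ℝ := fun x =>
  if Odd d then
    (-1) ^ ((d - 1) / 2) / √(Real.pi ^ (d - 1)) * (radialDeriv^[(d - 1) / 2] v) ‖x‖
  else
    2 * (-1) ^ (d / 2) / √(Real.pi ^ d) *
      ∫ t in Ioi ‖x‖, (radialDeriv^[d / 2] v) t / √(t ^ 2 - ‖x‖ ^ 2) * t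

/-- The temporal filters to which `R^♯` is applied: even functions with `k = ⌈(d - 1) / 2⌉`
continuous derivatives on `(0, ∞)` (in natural numbers `k = d / 2`) and decay
`∫_0^∞ t^{2k} |((1 / (2t)) ∂/∂t)^k v(t)| dt < ∞`. -/
structure IsRegularFilter (d : ℕ) (v : ℝ → ℝ) : Prop where
  even : ∀ t, v (-t) = v t
  contDiffOn : ContDiffOn ℝ (d / 2 : ℕ) v (Ioi 0)
  decay : IntegrableOn (fun t => t ^ (2 * (d / 2)) * (radialDeriv^[d / 2] v) t) (Ioi 0) volume

/-! ### The kernel `Φ` -/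

/-- The function `∑_j |F_d u_j|²`, with values in `ℂ`. -/
def frameSymbol {d : ℕ} (u : ℕ → E d → ℝ) : E d → ℂ := fun ξ =>
  ((∑' j, ‖𝓕 (fun x => (u j x : ℂ)) ξ‖ ^ 2 : ℝ) : ℂ)

open Classical in
/-- `Φ = F_d⁻¹ (∑_j |F_d u_j|²)`, the inverse Fourier transform of an `L^∞` function in the sense of
tempered distributions. It is the same distribution for the Fourier transform with kernel
`exp(-2πi x·ξ)`, used here, and for the one with kernel `exp(-i x·ξ)`, as long as the inverse
belongs to the same convention. -/
def frameKernel {d : ℕ} (u : ℕ → E d → ℝ) : 𝓢'(E d, ℂ) :=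
  if h : MemLp (frameSymbol u) ∞ (volume : Measure (E d)) then
    𝓕⁻ (Lp.toTemperedDistribution (h.toLp (frameSymbol u)))
  else 0

/-- The test function `y ↦ f(x - y)`. -/
def reflTranslate {d : ℕ} {f : E d → ℝ} (hf : ContDiff ℝ ∞ f) (hc : HasCompactSupport f)
    (x : E d) : 𝓢(E d, ℂ) :=
  HasCompactSupport.toSchwartzMap (f := fun y => ((f (x - y) : ℝ) : ℂ))
    ((hc.comp_homeomorph (Homeomorph.subLeft x)).comp_left (g := Complex.ofReal)
      Complex.ofReal_zero)
    (Complex.ofRealCLM.contDiff.comp (hf.comp (contDiff_const.sub contDiff_id)))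

/-- Convolution of a tempered distribution with `f ∈ C_c^∞`: `(T ⊛ f)(x) = T(f(x - ·))`. -/
def distConv {d : ℕ} (T : 𝓢'(E d, ℂ)) {f : E d → ℝ} (hf : ContDiff ℝ ∞ f)
    (hc : HasCompactSupport f) : E d → ℂ :=
  fun x => T (reflTranslate hf hc x)

end CSPAT

end

/-!
Everything happens on the Fourier side. For a test function `f`, uniqueness of the classical
solution identifies the pressure with `p(x, t) = ∫ cos(2π‖ξ‖t) f̂(ξ) e^{2πi⟨x, ξ⟩} dξ`
(`pressure_eq_fourierInv`). Convolving in space with `u` multiplies the density `f̂` by `û(ξ)`,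
filtering in time with an even `v` multiplies it by `v̂(‖ξ‖)` (`timeConv_pressure`). If both agree
at a single detector for all `t > 0` and all `f`, then letting `t → 0` and translating `f` gives
`û(ξ) = v̂(‖ξ‖)` (`fourier_eq_cosTransform`).

Uniqueness has to hold without growth conditions, so it rests on an energy estimate in backward
light cones (`eq_zero_of_wave`). The solution is obtained as a Fourier integral over the light cone
`τ = ±‖ξ‖` in frequency space, which makes its regularity immediate.

The Fourier slice theorem for `R^♯` reads `𝓕(R^♯ v)(ξ) = v̂(‖ξ‖)` (`fourier_radonSharp`). In dimension
`2k + 1` it amounts to recovering `v` from its `k`-th radial derivative `g` by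
`v(s) = 2 (-1)^k / (k-1)! ∫_s^∞ (t² - s²)^{k-1} g(t) t dt`: Taylor's formula gives this up to a
polynomial in `s²`, which vanishes because `v` is integrable (`eq_neg_integral_radialDeriv`). In
dimension `2k`, `R^♯ v` is the integral of its `(2k+1)`-dimensional version along lines.

Hence `(R^♯ v_j) ∗ (u_j ∗ f)` has Fourier transform `v̂_j(‖ξ‖) û_j f̂ = |û_j|² f̂`, as `û_j` is real.
The upper frame bound says `∑ |û_j|² ≤ B` pointwise (`sum_sq_norm_fourier_le`), so the series
converges unconditionally in `L²` by dominated convergence and Plancherel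
(`hasSum_fourierInv_symbol`), with sum `Φ ∗ f` by the definition of `Φ`. The compressed sensing
equations are the factorization at the sampling points, combined linearly.
-/

namespace CSPAT

/-! ### Fourier integrals in `L¹` and `L²` -/

section Fourier

variable {V : Type*} [NormedAddCommGroup V] [InnerProductSpace ℝ V] [FiniteDimensional ℝ V]
  [MeasurableSpace V] [BorelSpace V]

lemma integral_fourier_mul_eq {f g : V → ℂ} (hf : Integrable f) (hg : Integrable g) :
    ∫ ξ, 𝓕 f ξ * g ξ = ∫ x, f x * 𝓕 g x := by
  have := VectorFourier.integral_fourierIntegral_smul_eq_flip (L := innerₗ V) (μ := volume)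
    (ν := volume) Real.continuous_fourierChar continuous_inner hf hg
  simp only [smul_eq_mul, flip_innerₗ] at this
  exact this

lemma continuous_fourier {f : V → ℂ} (hf : Integrable f) : Continuous (𝓕 f) :=
  VectorFourier.fourierIntegral_continuous Real.continuous_fourierChar
    (continuous_inner (𝕜 := ℝ) (E := V)) hf

lemma continuous_fourierInv {f : V → ℂ} (hf : Integrable f) : Continuous (𝓕⁻ f) := by
  rw [Real.fourierInv_eq_fourier_comp_neg]
  exact continuous_fourier hf.comp_neg

lemma norm_fourier_le (f : V → ℂ) (ξ : V) : ‖𝓕 f ξ‖ ≤ ∫ x, ‖f x‖ :=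
  VectorFourier.norm_fourierIntegral_le_integral_norm _ _ _ _ _

lemma norm_fourierInv_le (f : V → ℂ) (ξ : V) : ‖𝓕⁻ f ξ‖ ≤ ∫ x, ‖f x‖ := by
  rw [Real.fourierInv_eq_fourier_neg]
  exact norm_fourier_le _ _

lemma integrable_fourierChar_mul {H : V → ℂ} (hH : Integrable H) (x : V) :
    Integrable (fun ξ => (Real.fourierChar (inner ℝ ξ x) : ℂ) * H ξ) := by
  refine hH.bdd_mul (c := 1) ?_ (.of_forall fun ξ => (Circle.norm_coe _).le)
  exact Continuous.aestronglyMeasurable (by fun_prop)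

/-- Convolution with an integrable kernel acts on an inverse Fourier integral by multiplying the
spectral density by the Fourier transform of the kernel. -/
lemma integral_mul_fourierInv_sub {r H : V → ℂ} (hr : Integrable r) (hH : Integrable H) (x : V) :
    ∫ y, r y * 𝓕⁻ H (x - y) = 𝓕⁻ (fun ξ => 𝓕 r ξ * H ξ) x := by
  have h1 := integral_fourier_mul_eq hr (integrable_fourierChar_mul hH x)
  rw [Real.fourierInv_eq]
  simp only [Circle.smul_def, smul_eq_mul]
  calc _ = ∫ y, r y * 𝓕 (fun ξ => (Real.fourierChar (inner ℝ ξ x) : ℂ) * H ξ) y := by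
        congr 1; ext y
        congr 1
        rw [Real.fourier_eq, Real.fourierInv_eq]
        congr 1; ext ξ
        simp only [Circle.smul_def, smul_eq_mul]
        rw [← mul_assoc, ← Circle.coe_mul, ← AddChar.map_add_eq_mul, inner_sub_right,
          sub_eq_neg_add]
    _ = _ := by
        rw [← h1]
        congr 1; ext ξ
        ring

lemma integrable_fourier_mul {r H : V → ℂ} (hr : Integrable r) (hH : Integrable H) :
    Integrable (fun ξ => 𝓕 r ξ * H ξ) :=
  hH.bdd_mul (continuous_fourier hr).aestronglyMeasurable (.of_forall fun ξ => norm_fourier_le r ξ)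

lemma memLp_two_fourier_mul {r H : V → ℂ} (hr : Integrable r) (hH : MemLp H 2) :
    MemLp (fun ξ => 𝓕 r ξ * H ξ) 2 :=
  MemLp.of_le_mul (c := ∫ x, ‖r x‖) hH
    ((continuous_fourier hr).aestronglyMeasurable.mul hH.1)
    (.of_forall fun ξ => by rw [norm_mul]; gcongr; exact norm_fourier_le r ξ)

/-- On `L¹ ∩ L²` the inverse Fourier integral is the `L²` inverse Fourier transform. -/
lemma fourierInv_toLp_ae_eq {H : V → ℂ} (hH : Integrable H) (hH2 : MemLp H 2) :
    (𝓕⁻ (hH2.toLp H) : Lp ℂ 2 (volume : Measure V)) =ᵐ[volume] 𝓕⁻ H := by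
  refine ae_eq_of_integral_contDiff_smul_eq
    ((Lp.memLp (𝓕⁻ (hH2.toLp H) : Lp ℂ 2 (volume : Measure V))).locallyIntegrable
      (by norm_num)) (continuous_fourierInv hH).locallyIntegrable ?_
  intro g g_smooth g_cpt
  have hg₁ : HasCompactSupport (Complex.ofRealCLM ∘ g) := g_cpt.comp_left rfl
  have hg₂ : ContDiff ℝ ∞ (Complex.ofRealCLM ∘ g) := by fun_prop
  set φ : 𝓢(V, ℂ) := hg₁.toSchwartzMap hg₂
  have h1 := congrArg (fun T : 𝓢'(V, ℂ) => T φ)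
    (MeasureTheory.Lp.fourierInv_toTemperedDistribution_eq (hH2.toLp H))
  simp only [TemperedDistribution.fourierInv_apply, Lp.toTemperedDistribution_apply] at h1
  have h2 : ∫ x, (𝓕⁻ φ) x • (hH2.toLp H) x = ∫ x, (𝓕⁻ φ) x • H x := by
    refine integral_congr_ae ?_
    filter_upwards [hH2.coeFn_toLp] with x hx
    rw [hx]
  have h4 := integral_fourier_mul_eq (φ.integrable (μ := volume)).comp_neg hH
  calc _ = ∫ x, φ x • (𝓕⁻ (hH2.toLp H) : Lp ℂ 2 (volume : Measure V)) x := by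
        congr 1
    _ = ∫ x, (𝓕⁻ φ) x • H x := by rw [← h1, h2]
    _ = ∫ x, 𝓕 (fun x => φ (-x)) x * H x := by
        rw [SchwartzMap.fourierInv_coe, Real.fourierInv_eq_fourier_comp_neg]; rfl
    _ = ∫ x, φ (-x) * 𝓕 H x := h4
    _ = ∫ x, φ x * 𝓕⁻ H x := by
        rw [← integral_neg_eq_self]
        simp only [neg_neg, Real.fourierInv_eq_fourier_neg]
    _ = _ := by congr 1

lemma memLp_two_fourierInv {H : V → ℂ} (hH : Integrable H) (hH2 : MemLp H 2) :
    MemLp (𝓕⁻ H) 2 :=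
  (Lp.memLp _).ae_eq (fourierInv_toLp_ae_eq hH hH2)

lemma toLp_fourierInv {H : V → ℂ} (hH : Integrable H) (hH2 : MemLp H 2)
    (h : MemLp (𝓕⁻ H) 2) : h.toLp (𝓕⁻ H) = 𝓕⁻ (hH2.toLp H) := by
  refine Lp.ext ?_
  filter_upwards [h.coeFn_toLp, fourierInv_toLp_ae_eq hH hH2] with x h1 h2
  rw [h1, h2]

/-- Plancherel's theorem for inverse Fourier integrals of functions in `L¹ ∩ L²`. -/
lemma eLpNorm_fourierInv {H : V → ℂ} (hH : Integrable H) (hH2 : MemLp H 2) :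
    eLpNorm (𝓕⁻ H) 2 = eLpNorm H 2 := by
  have h := memLp_two_fourierInv hH hH2
  have h1 : ‖h.toLp (𝓕⁻ H)‖ = ‖hH2.toLp H‖ := by
    rw [toLp_fourierInv hH hH2, ← Lp.norm_fourier_eq, FourierTransform.fourier_fourierInv_eq]
  rw [Lp.norm_toLp, Lp.norm_toLp] at h1
  exact (ENNReal.toReal_eq_toReal_iff' h.eLpNorm_ne_top hH2.eLpNorm_ne_top).1 h1

lemma fourierInv_im_eq_zero {H : V → ℂ} (hsymm : ∀ ξ, H (-ξ) = starRingEnd ℂ (H ξ)) (x : V) :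
    (𝓕⁻ H x).im = 0 := by
  rw [← Complex.conj_eq_iff_im, Real.fourierInv_eq, ← integral_conj, ← integral_neg_eq_self]
  congr 1; ext ξ
  simp only [Circle.smul_def, smul_eq_mul, map_mul, hsymm, Complex.conj_conj, inner_neg_left]
  congr 1
  rw [← Circle.coe_inv_eq_conj, AddChar.map_neg_eq_inv, inv_inv]

lemma fourier_neg_of_real (u : V → ℝ) (ξ : V) :
    𝓕 (fun x => (u x : ℂ)) (-ξ) = starRingEnd ℂ (𝓕 (fun x => (u x : ℂ)) ξ) := by
  rw [Real.fourier_eq, Real.fourier_eq, ← integral_conj]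
  congr 1; ext x
  simp only [Circle.smul_def, smul_eq_mul, map_mul, Complex.conj_ofReal]
  congr 1
  rw [← Circle.coe_inv_eq_conj, ← AddChar.map_neg_eq_inv, inner_neg_right]

/-- The convolution of a real kernel `r ∈ L¹` with a real function that is an inverse Fourier
integral. -/
lemma ofReal_conv {r h : V → ℝ} {H : V → ℂ} (hr : Integrable r) (hH : Integrable H)
    (hh : ∀ x, (h x : ℂ) = 𝓕⁻ H x) (x : V) :
    ((conv r h x : ℝ) : ℂ) = 𝓕⁻ (fun ξ => 𝓕 (fun x => (r x : ℂ)) ξ * H ξ) x := by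
  have hr' : Integrable (fun x => (r x : ℂ)) := hr.ofReal
  rw [← integral_mul_fourierInv_sub hr' hH, conv, convolution_def, ← integral_complex_ofReal]
  congr 1; ext y
  simp [hh]

lemma continuous_of_eq_fourierInv {h : V → ℝ} {H : V → ℂ} (hH : Integrable H)
    (hh : ∀ x, (h x : ℂ) = 𝓕⁻ H x) : Continuous h := by
  have : h = fun x => (𝓕⁻ H x).re := by ext x; rw [← hh]; simp
  rw [this]
  exact Complex.continuous_re.comp (continuous_fourierInv hH)

lemma convolutionExists_of_bounded {r h : V → ℝ} {C : ℝ} (hr : Integrable r) (hc : Continuous h)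
    (hC : ∀ x, ‖h x‖ ≤ C) : ConvolutionExists r h (ContinuousLinearMap.mul ℝ ℝ) volume := by
  intro x
  have : Integrable (fun t => r t * h (x - t)) :=
    hr.mul_bdd (c := C) (Continuous.aestronglyMeasurable (by fun_prop)) (.of_forall fun t => hC _)
  exact this

end Fourier

/-! ### Frame bounds in the Fourier domain -/

section Frames

variable {V : Type*} [NormedAddCommGroup V] [InnerProductSpace ℝ V] [FiniteDimensional ℝ V]
  [MeasurableSpace V] [BorelSpace V]

lemma eLpNorm_two_sq {F : V → ℂ} (hF : MemLp F 2) :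
    eLpNorm F 2 ^ 2 = ENNReal.ofReal (∫ ξ, ‖F ξ‖ ^ 2) := by
  have h := eLpNorm_nnreal_pow_eq_lintegral (f := F) (μ := volume) (p := 2) (by norm_num)
  rw [ofReal_integral_eq_lintegral_ofReal ((memLp_two_iff_integrable_sq_norm hF.1).1 hF)
    (.of_forall fun _ => by positivity)]
  have e : ((2 : NNReal) : ℝ) = ((2 : ℕ) : ℝ) := by norm_num
  simp only [e, ENNReal.rpow_natCast, ENNReal.coe_ofNat] at h
  rw [h]
  congr 1; ext ξ
  rw [ENNReal.ofReal_pow (norm_nonneg _), ofReal_norm]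

lemma eLpNorm_ofReal (h : V → ℝ) (p : ℝ≥0∞) :
    eLpNorm (fun x => (h x : ℂ)) p volume = eLpNorm h p volume :=
  eLpNorm_congr_norm_ae (.of_forall fun x => by simp)

/-- The upper frame bound controls the symbol: testing with real functions whose spectrum
concentrates near `±ξ` turns `∑ ‖u_j ⊛ h‖² ≤ B ‖h‖²` into a pointwise bound. -/
lemma sum_sq_norm_fourier_le {ι : Type*} {u : ι → V → ℝ} (hu : ∀ j, Integrable (u j)) {B : ℝ}
    (hB : 0 ≤ B)
    (hbound : ∀ f : V → ℝ, MemLp f 2 volume →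
      ∑' l, eLpNorm (conv (u l) f) 2 volume ^ 2 ≤ ENNReal.ofReal B * eLpNorm f 2 volume ^ 2)
    (s : Finset ι) (ξ : V) : ∑ j ∈ s, ‖𝓕 (fun x => (u j x : ℂ)) ξ‖ ^ 2 ≤ B := by
  by_contra! hlt
  have hu' : ∀ j, Integrable (fun x => (u j x : ℂ)) := fun j => (hu j).ofReal
  set M : V → ℝ := fun ξ => ∑ j ∈ s, ‖𝓕 (fun x => (u j x : ℂ)) ξ‖ ^ 2 with hM
  have hMc : Continuous M :=
    continuous_finsetSum _ fun j _ => ((continuous_fourier (hu' j)).norm.pow 2)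
  have hMneg : ∀ ξ, M (-ξ) = M ξ := by
    intro ξ
    simp only [hM, fourier_neg_of_real, RCLike.norm_conj]
  obtain ⟨ε, hε, hball⟩ := Metric.eventually_nhds_iff_ball.1 (hMc.continuousAt.eventually
    (lt_mem_nhds hlt))
  -- the inverse Fourier transform of an even real bump supported near `±ξ` is a real function
  let φ : ContDiffBump ξ := ⟨ε / 2, ε, by positivity, by linarith⟩
  let K : V → ℂ := fun η => ((φ η + φ (-η) : ℝ) : ℂ)
  have hKsm : ContDiff ℝ ∞ K :=
    Complex.ofRealCLM.contDiff.comp (φ.contDiff.add (φ.contDiff.comp contDiff_neg))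
  have hKc : HasCompactSupport K :=
    (φ.hasCompactSupport.add (φ.hasCompactSupport.comp_homeomorph (Homeomorph.neg V))).comp_left
      (g := Complex.ofReal) Complex.ofReal_zero
  have hK1 : Integrable K := hKsm.continuous.integrable_of_hasCompactSupport hKc
  have hK2 : MemLp K 2 := hKsm.continuous.memLp_of_hasCompactSupport hKc
  have hKsymm : ∀ η, K (-η) = starRingEnd ℂ (K η) := by
    intro η
    simp only [K, neg_neg, Complex.conj_ofReal, add_comm]
  let h : V → ℝ := fun x => (𝓕⁻ K x).re
  have hh : ∀ x, (h x : ℂ) = 𝓕⁻ K x := fun x =>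
    Complex.ext (by simp [h]) (by simp [fourierInv_im_eq_zero hKsymm])
  have hh' : (fun x => (h x : ℂ)) = 𝓕⁻ K := funext hh
  have hh2 : MemLp h 2 := (memLp_two_fourierInv hK1 hK2).re
  have hnorm : eLpNorm h 2 volume ^ 2 = ENNReal.ofReal (∫ η, ‖K η‖ ^ 2) := by
    rw [← eLpNorm_ofReal, hh', eLpNorm_fourierInv hK1 hK2, eLpNorm_two_sq hK2]
  have hterm : ∀ j, eLpNorm (conv (u j) h) 2 volume ^ 2 =
      ENNReal.ofReal (∫ η, ‖𝓕 (fun x => (u j x : ℂ)) η * K η‖ ^ 2) := by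
    intro j
    rw [← eLpNorm_ofReal, funext (ofReal_conv (hu j) hK1 hh),
      eLpNorm_fourierInv (integrable_fourier_mul (hu' j) hK1) (memLp_two_fourier_mul (hu' j) hK2),
      eLpNorm_two_sq (memLp_two_fourier_mul (hu' j) hK2)]
  have hint : ∀ j, Integrable fun η => ‖𝓕 (fun x => (u j x : ℂ)) η * K η‖ ^ 2 := fun j =>
    (memLp_two_iff_integrable_sq_norm (memLp_two_fourier_mul (hu' j) hK2).1).1
      (memLp_two_fourier_mul (hu' j) hK2)
  have hintK : Integrable fun η => ‖K η‖ ^ 2 := (memLp_two_iff_integrable_sq_norm hK2.1).1 hK2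
  have h1 : ∑ j ∈ s, ∫ η, ‖𝓕 (fun x => (u j x : ℂ)) η * K η‖ ^ 2 ≤ B * ∫ η, ‖K η‖ ^ 2 := by
    have := (ENNReal.sum_le_tsum s).trans (hbound h hh2)
    simp only [hterm, hnorm] at this
    rw [← ENNReal.ofReal_sum_of_nonneg (fun _ _ => integral_nonneg fun _ => by positivity),
      ← ENNReal.ofReal_mul hB] at this
    exact (ENNReal.ofReal_le_ofReal_iff
      (mul_nonneg hB (integral_nonneg fun _ => by positivity))).1 this
  have h2 : ∫ η, (M η - B) * ‖K η‖ ^ 2 ≤ 0 := by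
    rw [← integral_finsetSum _ fun j _ => hint j, ← integral_const_mul, ← sub_nonpos,
      ← integral_sub (integrable_finsetSum _ fun j _ => hint j) (hintK.const_mul B)] at h1
    refine le_of_eq_of_le (integral_congr_ae (.of_forall fun η => ?_)) h1
    simp only [hM, norm_mul, mul_pow, ← Finset.sum_mul]
    ring
  have hpos : 0 < ∫ η, (M η - B) * ‖K η‖ ^ 2 := by
    refine Continuous.integral_pos_of_hasCompactSupport_nonneg_nonzero (x := ξ) ?_ ?_ ?_ ?_
    · exact (hMc.sub continuous_const).mul (hKsm.continuous.norm.pow 2)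
    · have : HasCompactSupport fun η => ‖K η‖ ^ 2 := hKc.comp_left (g := fun z : ℂ => ‖z‖ ^ 2)
        (by simp)
      exact this.mul_left
    · intro η
      change 0 ≤ (M η - B) * ‖K η‖ ^ 2
      by_cases hη : η ∈ Metric.ball ξ ε
      · exact mul_nonneg (sub_nonneg.2 (hball η hη).le) (by positivity)
      by_cases hη' : -η ∈ Metric.ball ξ ε
      · have := hball _ hη'
        rw [hMneg] at this
        exact mul_nonneg (sub_nonneg.2 this.le) (by positivity)
      have e1 : φ η = 0 := φ.zero_of_le_dist (by simpa [φ] using hη)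
      have e2 : φ (-η) = 0 := φ.zero_of_le_dist (by simpa [φ] using hη')
      simp [K, e1, e2]
    · have e1 : φ ξ = 1 := φ.one_of_mem_closedBall (Metric.mem_closedBall_self φ.rIn_pos.le)
      have e2 : 0 ≤ φ (-ξ) := φ.nonneg
      have e3 : 0 < ‖K ξ‖ := by
        rw [norm_pos_iff]
        simp only [K, e1]
        exact_mod_cast (by linarith : (1 : ℝ) + φ (-ξ) ≠ 0)
      exact (mul_pos (sub_pos.2 hlt) (by positivity)).ne'
  exact absurd hpos h2.not_gt

end Frames

/-! ### The frame symbol and the kernel `Φ` -/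

section Symbol

variable {d : ℕ}

lemma IsConvFrame.integrable {ι G : Type*} [NormedAddCommGroup G] [MeasureSpace G]
    {u : ι → G → ℝ} (hu : IsConvFrame u) (j : ι) :
    Integrable (u j) := memLp_one_iff_integrable.1 (hu.memLp_one j)

lemma IsConvFrame.exists_sum_le {ι : Type*} {u : ι → E d → ℝ} (hu : IsConvFrame u) :
    ∃ B : ℝ, ∀ (s : Finset ι) (ξ : E d), ∑ j ∈ s, ‖𝓕 (fun x => (u j x : ℂ)) ξ‖ ^ 2 ≤ B := by
  obtain ⟨A, B, -, hB, h⟩ := hu.bounds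
  exact ⟨B, sum_sq_norm_fourier_le hu.integrable hB.le fun f hf => (h f hf).2⟩

lemma IsConvFrame.summable {ι : Type*} {u : ι → E d → ℝ} (hu : IsConvFrame u) (ξ : E d) :
    Summable fun j => ‖𝓕 (fun x => (u j x : ℂ)) ξ‖ ^ 2 := by
  obtain ⟨B, hB⟩ := hu.exists_sum_le
  exact summable_of_sum_le (fun _ => by positivity) fun s => hB s ξ

lemma IsConvFrame.exists_norm_frameSymbol_le {u : ℕ → E d → ℝ} (hu : IsConvFrame u) :
    ∃ B : ℝ, ∀ ξ, ‖frameSymbol u ξ‖ ≤ B := by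
  obtain ⟨B, hB⟩ := hu.exists_sum_le
  refine ⟨B, fun ξ => ?_⟩
  rw [frameSymbol, Complex.norm_real, Real.norm_of_nonneg (tsum_nonneg fun _ => by positivity)]
  exact (hu.summable ξ).tsum_le_of_sum_le fun s => hB s ξ

lemma IsConvFrame.memLp_frameSymbol {u : ℕ → E d → ℝ} (hu : IsConvFrame u) :
    MemLp (frameSymbol u) ∞ volume := by
  obtain ⟨B, hB⟩ := hu.exists_norm_frameSymbol_le
  refine memLp_top_of_bound ?_ B (.of_forall hB)
  refine (Complex.measurable_ofReal.comp ?_).aestronglyMeasurable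
  refine Measurable.tsum fun j => ?_
  have hj : Integrable (fun x => (u j x : ℂ)) := (hu.integrable j).ofReal
  exact ((continuous_fourier hj).norm.pow 2).measurable

/-- A test function as a complex-valued Schwartz function. -/
noncomputable def testSchwartz {f : E d → ℝ} (hf : ContDiff ℝ ∞ f) (hc : HasCompactSupport f) :
    𝓢(E d, ℂ) :=
  HasCompactSupport.toSchwartzMap (f := fun y => (f y : ℂ))
    (hc.comp_left (g := Complex.ofReal) Complex.ofReal_zero) (Complex.ofRealCLM.contDiff.comp hf)

lemma testSchwartz_apply {f : E d → ℝ} (hf : ContDiff ℝ ∞ f) (hc : HasCompactSupport f) (x : E d) :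
    testSchwartz hf hc x = f x := rfl

/-- The Fourier transform of a test function, as a Schwartz function. -/
noncomputable def testFourier {f : E d → ℝ} (hf : ContDiff ℝ ∞ f) (hc : HasCompactSupport f) :
    𝓢(E d, ℂ) := 𝓕 (testSchwartz hf hc)

lemma testFourier_apply {f : E d → ℝ} (hf : ContDiff ℝ ∞ f) (hc : HasCompactSupport f) (ξ : E d) :
    testFourier hf hc ξ = 𝓕 (fun x => (f x : ℂ)) ξ := rfl

lemma ofReal_eq_fourierInv {f : E d → ℝ} (hf : ContDiff ℝ ∞ f) (hc : HasCompactSupport f)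
    (x : E d) : (f x : ℂ) = 𝓕⁻ (testFourier hf hc : E d → ℂ) x := by
  rw [← testSchwartz_apply hf hc, testFourier, ← SchwartzMap.fourierInv_coe,
    FourierTransform.fourierInv_fourier_eq]

/-- Convolving `Φ` with a test function multiplies its Fourier transform by the frame symbol. -/
lemma distConv_frameKernel {u : ℕ → E d → ℝ} (hu : IsConvFrame u) {f : E d → ℝ}
    (hf : ContDiff ℝ ∞ f) (hc : HasCompactSupport f) (x : E d) :
    distConv (frameKernel u) hf hc x =
      𝓕⁻ (fun ξ => frameSymbol u ξ * testFourier hf hc ξ) x := by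
  rw [distConv, frameKernel, dif_pos hu.memLp_frameSymbol, TemperedDistribution.fourierInv_apply,
    Lp.toTemperedDistribution_apply, Real.fourierInv_eq]
  refine integral_congr_ae ?_
  filter_upwards [hu.memLp_frameSymbol.coeFn_toLp] with ξ hξ
  rw [hξ]
  have : (𝓕⁻ (reflTranslate hf hc x)) ξ =
      (Real.fourierChar (inner ℝ ξ x) : ℂ) * testFourier hf hc ξ := by
    rw [SchwartzMap.fourierInv_coe, testFourier_apply, Real.fourierInv_eq, Real.fourier_eq,
      ← integral_const_mul, ← integral_sub_left_eq_self _ volume x]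
    congr 1; ext y
    simp only [Circle.smul_def, smul_eq_mul]
    rw [← mul_assoc, ← Circle.coe_mul, ← AddChar.map_add_eq_mul, inner_sub_left,
      ← sub_eq_add_neg, real_inner_comm x ξ]
    change _ * ((f (x - (x - y)) : ℝ) : ℂ) = _
    rw [sub_sub_cancel]
  rw [this]
  simp only [Circle.smul_def, smul_eq_mul]
  ring

end Symbol

/-! ### Second derivatives along space and time slices -/

section Slices

/-- Second derivatives of the restriction of a function to an affine subspace. -/
lemma fderiv_fderiv_comp_affine {U X : Type*} [NormedAddCommGroup U] [NormedSpace ℝ U]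
    [NormedAddCommGroup X] [NormedSpace ℝ X] {Q : X → ℝ} (a : X) (L : U →L[ℝ] X) {y : U}
    (hQ : ContDiffAt ℝ 2 Q (a + L y)) (m n : U) :
    fderiv ℝ (fderiv ℝ fun z => Q (a + L z)) y m n =
      fderiv ℝ (fderiv ℝ Q) (a + L y) (L m) (L n) := by
  have hA : ∀ z, HasFDerivAt (fun z => a + L z) L z := fun z => (L.hasFDerivAt).const_add a
  have h1 : ∀ᶠ z in 𝓝 y, fderiv ℝ (fun z => Q (a + L z)) z = (fderiv ℝ Q (a + L z)).comp L := by
    have hev : ∀ᶠ q in 𝓝 (a + L y), ContDiffAt ℝ 2 Q q := hQ.eventually (by simp)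
    have hc : Tendsto (fun z => a + L z) (𝓝 y) (𝓝 (a + L y)) := (hA y).continuousAt
    filter_upwards [hc.eventually hev] with z hz
    exact (((hz.differentiableAt (by norm_num)).hasFDerivAt).comp z (hA z)).fderiv
  have h2 : HasFDerivAt (fderiv ℝ Q) (fderiv ℝ (fderiv ℝ Q) (a + L y)) (a + L y) :=
    ((hQ.fderiv_right (m := 1) (by norm_num)).differentiableAt (by norm_num)).hasFDerivAt
  have h3 := (h2.comp y (hA y)).clm_comp (hasFDerivAt_const L y)
  rw [(h3.congr_of_eventuallyEq h1).fderiv]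
  simp

variable {d : ℕ} {Q : E d × ℝ → ℝ} {x : E d} {t : ℝ}

lemma iteratedDeriv_two_slice (hQ : ContDiffAt ℝ 2 Q (x, t)) :
    iteratedDeriv 2 (fun s => Q (x, s)) t = fderiv ℝ (fderiv ℝ Q) (x, t) (0, 1) (0, 1) := by
  have h := fderiv_fderiv_comp_affine (y := t) ((x, 0) : E d × ℝ) (ContinuousLinearMap.inr ℝ (E d) ℝ)
    (by simpa using hQ) 1 1
  simp only [ContinuousLinearMap.inr_apply, Prod.mk_add_mk, add_zero, zero_add] at h
  rw [← h, iteratedDeriv_eq_iteratedFDeriv, iteratedFDeriv_two_apply]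

lemma laplacian_slice (hQ : ContDiffAt ℝ 2 Q (x, t)) :
    Δ (fun y => Q (y, t)) x = ∑ i : Fin d, fderiv ℝ (fderiv ℝ Q) (x, t)
      (EuclideanSpace.single i 1, 0) (EuclideanSpace.single i 1, 0) := by
  rw [InnerProductSpace.laplacian_eq_iteratedFDeriv_orthonormalBasis _
    (EuclideanSpace.basisFun (Fin d) ℝ)]
  refine Finset.sum_congr rfl fun i _ => ?_
  have h := fderiv_fderiv_comp_affine (y := x) ((0, t) : E d × ℝ) (ContinuousLinearMap.inl ℝ (E d) ℝ)
    (by simpa using hQ) (EuclideanSpace.single i 1) (EuclideanSpace.single i 1)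
  simp only [ContinuousLinearMap.inl_apply, Prod.mk_add_mk, add_zero, zero_add] at h
  rw [← h, iteratedFDeriv_two_apply]
  simp

end Slices

/-! ### The cone weight -/

section Weight

lemma hasDerivAt_sq_posPart (s : ℝ) :
    HasDerivAt (fun s : ℝ => max s 0 ^ 2) (2 * max s 0) s := by
  rcases lt_trichotomy s 0 with hs | rfl | hs
  · rw [max_eq_right hs.le]
    have : (fun s : ℝ => max s 0 ^ 2) =ᶠ[𝓝 s] fun _ => 0 := by
      filter_upwards [gt_mem_nhds hs] with y hy
      simp [max_eq_right (le_of_lt hy)]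
    simpa using (hasDerivAt_const s (0 : ℝ)).congr_of_eventuallyEq this
  · rw [hasDerivAt_iff_isLittleO]
    have h1 : (fun s : ℝ => max s 0 ^ 2) =O[𝓝 0] fun s : ℝ => s ^ 2 := by
      refine Asymptotics.isBigO_of_le _ fun s => ?_
      rw [norm_pow, norm_pow]
      gcongr
      rw [Real.norm_eq_abs, Real.norm_eq_abs, abs_of_nonneg (le_max_right _ _)]
      exact max_le (le_abs_self _) (abs_nonneg _)
    have h2 : (fun s : ℝ => s ^ 2) =o[𝓝 0] fun s : ℝ => s := by
      simpa using Asymptotics.isLittleO_pow_pow (𝕜 := ℝ) (m := 1) (n := 2) (by norm_num)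
    simpa using h1.trans_isLittleO h2
  · rw [max_eq_left hs.le]
    have : (fun s : ℝ => max s 0 ^ 2) =ᶠ[𝓝 s] fun s => s ^ 2 := by
      filter_upwards [lt_mem_nhds hs] with y hy
      simp [max_eq_left (le_of_lt hy)]
    simpa using (hasDerivAt_pow 2 s).congr_of_eventuallyEq this

variable {d : ℕ}

/-- A smooth function on `ℝ^d` whose gradient has norm less than one and that is at least
`‖x‖`. -/
noncomputable def coneRadius (x : E d) : ℝ := √(1 + ‖x‖ ^ 2)

lemma coneRadius_pos (x : E d) : 0 < coneRadius x := Real.sqrt_pos.2 (by positivity)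

lemma norm_le_coneRadius (x : E d) : ‖x‖ ≤ coneRadius x :=
  Real.le_sqrt_of_sq_le (by linarith)

lemma continuous_coneRadius : Continuous (coneRadius (d := d)) := by
  unfold coneRadius; fun_prop

lemma hasFDerivAt_coneRadius (x : E d) :
    HasFDerivAt coneRadius ((coneRadius x)⁻¹ • innerSL ℝ x) x := by
  have h := ((hasStrictFDerivAt_norm_sq x).hasFDerivAt.const_add 1).sqrt (by positivity)
  refine h.congr_fderiv ?_
  ext y
  change _ = (√(1 + ‖x‖ ^ 2))⁻¹ * inner ℝ x y
  simp
  field_simp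

lemma sum_sq_div_coneRadius_lt_one (x : E d) : ∑ i, (x i / coneRadius x) ^ 2 < 1 := by
  simp only [div_pow, ← Finset.sum_div]
  rw [div_lt_one (pow_pos (coneRadius_pos x) 2), coneRadius, Real.sq_sqrt (by positivity),
    EuclideanSpace.norm_sq_eq]
  simp

/-- The distance to the boundary of a smoothed backward light cone of height `R`, zero outside. -/
noncomputable def coneDepth (R : ℝ) (q : E d × ℝ) : ℝ := max (R - q.2 - coneRadius q.1) 0

lemma coneDepth_nonneg (R : ℝ) (q : E d × ℝ) : 0 ≤ coneDepth R q := le_max_right _ _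

lemma continuous_coneDepth (R : ℝ) : Continuous (coneDepth (d := d) R) := by
  have := continuous_coneRadius (d := d)
  unfold coneDepth; fun_prop

lemma coneDepth_eq_zero {R : ℝ} {q : E d × ℝ} (h : R ≤ q.2 + coneRadius q.1) :
    coneDepth R q = 0 := max_eq_right (by linarith)

lemma hasFDerivAt_coneDepth_sq (R : ℝ) (q : E d × ℝ) :
    HasFDerivAt (fun q => coneDepth R q ^ 2) ((2 * coneDepth R q) •
      (-ContinuousLinearMap.snd ℝ (E d) ℝ -
        ((coneRadius q.1)⁻¹ • innerSL ℝ q.1).comp (ContinuousLinearMap.fst ℝ (E d) ℝ))) q := by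
  have h1 : HasFDerivAt (fun q : E d × ℝ => R - q.2 - coneRadius q.1)
      (-ContinuousLinearMap.snd ℝ (E d) ℝ -
        ((coneRadius q.1)⁻¹ • innerSL ℝ q.1).comp (ContinuousLinearMap.fst ℝ (E d) ℝ)) q :=
    (hasFDerivAt_snd.const_sub R).sub ((hasFDerivAt_coneRadius q.1).comp q hasFDerivAt_fst)
  exact (hasDerivAt_sq_posPart _).comp_hasFDerivAt q h1

end Weight

/-! ### Integration over the half space -/

section Uniqueness

lemma integral_fderiv_apply_eq_zero {V : Type*} [NormedAddCommGroup V] [NormedSpace ℝ V]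
    [FiniteDimensional ℝ V] [MeasurableSpace V] [BorelSpace V] {μ : Measure V}
    [μ.IsAddHaarMeasure] {F : V → ℝ} {F' : V → V →L[ℝ] ℝ} (hF : ∀ x, HasFDerivAt F (F' x) x)
    (m : V) (hint : Integrable F μ) (hint' : Integrable (fun x => F' x m) μ) :
    ∫ x, F' x m ∂μ = 0 := by
  have h := integral_mul_fderiv_eq_neg_fderiv_mul_of_integrable (μ := μ) (f := fun _ : V => (1 : ℝ))
    (g := F) (v := m) (by simp) (by simpa [(hF _).fderiv] using hint') (by simpa using hint)
    (fun _ _ => by fun_prop) (fun x _ => (hF x).differentiableAt)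
  simpa [(hF _).fderiv] using h

variable {d : ℕ}

lemma uniqueDiffOn_halfSpace : UniqueDiffOn ℝ (univ ×ˢ Ici 0 : Set (E d × ℝ)) :=
  uniqueDiffOn_univ.prod (uniqueDiffOn_Ici 0)

/-- Fields that are continuous up to the initial time and vanish outside a backward light cone are
integrable, since the cone meets the closed half space in a bounded set. -/
lemma integrableOn_halfSpace {g : E d × ℝ → ℝ} {R : ℝ}
    (hg : ContinuousOn g (univ ×ˢ Ici 0)) (hz : ∀ q, coneDepth R q = 0 → g q = 0) :
    IntegrableOn g (univ ×ˢ Ioi 0) := by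
  have hK : IsCompact (Metric.closedBall (0 : E d) R ×ˢ Icc 0 R) :=
    (isCompact_closedBall _ _).prod isCompact_Icc
  have h1 : IntegrableOn g (Metric.closedBall (0 : E d) R ×ˢ Icc 0 R) :=
    (hg.mono (prod_mono (subset_univ _) Icc_subset_Ici_self)).integrableOn_compact hK
  refine h1.of_forall_sdiff_eq_zero (MeasurableSet.univ.prod measurableSet_Ioi) ?_
  rintro ⟨x, t⟩ ⟨⟨-, ht⟩, hq⟩
  refine hz _ (coneDepth_eq_zero ?_)
  by_contra! hlt
  have h2 := norm_le_coneRadius x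
  have h3 := coneRadius_pos x
  have ht' : 0 < t := ht
  exact hq ⟨by simpa using (by simp at hlt; linarith), ht'.le, by simp at hlt; linarith⟩

/-- Completing the square in the energy flux; the right-hand side is nonnegative for `∑ a_i² < 1`. -/
lemma sum_form_identity (A : ℝ) (a B : Fin d → ℝ) :
    A ^ 2 + ∑ i, B i ^ 2 - 2 * A * ∑ i, a i * B i =
      ∑ i, (B i - a i * A) ^ 2 + A ^ 2 * (1 - ∑ i, a i ^ 2) := by
  have : ∑ i, (B i - a i * A) ^ 2 =
      ∑ i, B i ^ 2 - 2 * A * ∑ i, a i * B i + A ^ 2 * ∑ i, a i ^ 2 := by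
    simp only [Finset.mul_sum, ← Finset.sum_sub_distrib, ← Finset.sum_add_distrib]
    exact Finset.sum_congr rfl fun i _ => by ring
  rw [this]; ring

end Uniqueness

/-! ### Uniqueness for the wave equation -/

section Energy

variable {d : ℕ} {R : ℝ} {F g : E d × ℝ → ℝ}

lemma setIntegral_time_deriv_eq_zero (hF : ContinuousOn F (univ ×ˢ Ici 0))
    (hF0 : ∀ x, F (x, 0) = 0) (hFz : ∀ q, coneDepth R q = 0 → F q = 0)
    (hg : ContinuousOn g (univ ×ˢ Ici 0)) (hgz : ∀ q, coneDepth R q = 0 → g q = 0)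
    (hder : ∀ x t, 0 < t → HasDerivAt (fun s => F (x, s)) (g (x, t)) t) :
    ∫ q in univ ×ˢ Ioi 0, g q = 0 := by
  have hint := integrableOn_halfSpace hg hgz
  rw [Measure.volume_eq_prod] at hint ⊢
  rw [setIntegral_prod _ hint, setIntegral_univ]
  refine (integral_congr_ae ?_).trans (integral_zero _ _)
  rw [IntegrableOn, ← Measure.prod_restrict, Measure.restrict_univ] at hint
  filter_upwards [hint.prod_right_ae] with x hx
  have hc : ContinuousWithinAt (fun s => F (x, s)) (Ici 0) 0 :=
    ((hF (x, 0) ⟨mem_univ _, self_mem_Ici⟩).comp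
      (Continuous.continuousWithinAt (by fun_prop)) fun s hs => ⟨mem_univ _, hs⟩)
  have hlim : Tendsto (fun s => F (x, s)) atTop (𝓝 0) := by
    refine tendsto_const_nhds.congr' ?_
    filter_upwards [eventually_ge_atTop R] with s hs
    refine (hFz _ (coneDepth_eq_zero ?_)).symm
    have := coneRadius_pos x
    simp only
    linarith
  rw [integral_Ioi_of_hasDerivAt_of_tendsto hc (fun t ht => hder x t ht) hx hlim, hF0]
  simp

lemma setIntegral_space_deriv_eq_zero (e : E d) (hF : ContinuousOn F (univ ×ˢ Ici 0))
    (hFz : ∀ q, coneDepth R q = 0 → F q = 0)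
    (hg : ContinuousOn g (univ ×ˢ Ici 0)) (hgz : ∀ q, coneDepth R q = 0 → g q = 0)
    {F' : E d → ℝ → E d →L[ℝ] ℝ}
    (hder : ∀ x t, 0 < t → HasFDerivAt (fun y => F (y, t)) (F' x t) x)
    (hF' : ∀ x t, 0 < t → F' x t e = g (x, t)) :
    ∫ q in univ ×ˢ Ioi 0, g q = 0 := by
  have hint := integrableOn_halfSpace hg hgz
  have hintF := integrableOn_halfSpace hF hFz
  rw [Measure.volume_eq_prod] at hint hintF ⊢
  rw [IntegrableOn, ← Measure.prod_restrict, Measure.restrict_univ] at hint hintF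
  rw [← Measure.prod_restrict, Measure.restrict_univ, integral_prod_symm _ hint]
  refine (integral_congr_ae ?_).trans (integral_zero _ _)
  filter_upwards [hint.prod_left_ae, hintF.prod_left_ae, ae_restrict_mem measurableSet_Ioi]
    with t h1 h2 ht
  simp only [← hF' _ t ht] at h1 ⊢
  exact integral_fderiv_apply_eq_zero (fun x => hder x t ht) e h2 h1

/-- Uniqueness for the wave equation without growth conditions. The energy density weighted by
the squared depth in a backward light cone gives a compactly supported field whose divergence has a
sign; its integral over the half space vanishes, so the time derivative vanishes inside the cone. -/
theorem eq_zero_of_wave {Q : E d × ℝ → ℝ} (hQ : ContDiffOn ℝ 2 Q (univ ×ˢ Ici 0))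
    (hwave : ∀ x t, 0 < t → iteratedDeriv 2 (fun s => Q (x, s)) t = Δ (fun y => Q (y, t)) x)
    (h0 : ∀ x, Q (x, 0) = 0) (h0' : ∀ x, HasDerivWithinAt (fun s => Q (x, s)) 0 (Ici 0) 0)
    (x : E d) {t : ℝ} (ht : 0 ≤ t) : Q (x, t) = 0 := by
  set H : Set (E d × ℝ) := univ ×ˢ Ici 0 with hH
  have hu : UniqueDiffOn ℝ H := uniqueDiffOn_halfSpace
  set G := fderivWithin ℝ Q H with hG
  set D := fderivWithin ℝ G H with hD
  have hG1 : ContDiffOn ℝ 1 G H := hQ.fderivWithin hu (by norm_num)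
  have hGc : ContinuousOn G H := hG1.continuousOn
  have hDc : ContinuousOn D H := hG1.continuousOn_fderivWithin hu (by norm_num)
  have hnhds : ∀ x t, 0 < t → H ∈ 𝓝 ((x, t) : E d × ℝ) := fun x t ht =>
    prod_mem_nhds univ_mem (Ici_mem_nhds ht)
  have hmem : ∀ x t, 0 < t → ((x, t) : E d × ℝ) ∈ H := fun x t ht => ⟨mem_univ _, ht.le⟩
  have hQat : ∀ x t, 0 < t → ContDiffAt ℝ 2 Q (x, t) := fun x t ht =>
    hQ.contDiffAt (hnhds x t ht)
  have hQd : ∀ q ∈ H, HasFDerivWithinAt Q (G q) H q := fun q hq =>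
    (hQ.differentiableOn (by norm_num) q hq).hasFDerivWithinAt
  have hQder : ∀ x t, 0 < t → HasFDerivAt Q (G (x, t)) (x, t) := fun x t ht =>
    (hQd _ (hmem x t ht)).hasFDerivAt (hnhds x t ht)
  have hGder : ∀ x t, 0 < t → HasFDerivAt G (D (x, t)) (x, t) := fun x t ht =>
    ((hG1.differentiableOn (by norm_num) _ (hmem x t ht)).hasFDerivWithinAt).hasFDerivAt
      (hnhds x t ht)
  have hD2 : ∀ x t, 0 < t → D (x, t) = fderiv ℝ (fderiv ℝ Q) (x, t) := by
    intro x t ht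
    refine ((hGder x t ht).congr_of_eventuallyEq ?_).fderiv.symm
    have : ∀ᶠ q : E d × ℝ in 𝓝 (x, t), 0 < q.2 := continuous_snd.continuousAt.eventually
      (lt_mem_nhds ht)
    filter_upwards [this] with q hq
    exact (hQder q.1 q.2 hq).fderiv
  have hsymm : ∀ x t, 0 < t → ∀ m n, D (x, t) m n = D (x, t) n m := by
    intro x t ht m n
    rw [hD2 x t ht]
    exact (hQat x t ht).isSymmSndFDerivAt (by simp) m n
  set τ : E d × ℝ := (0, 1)
  set e : Fin d → E d × ℝ := fun i => (EuclideanSpace.single i 1, 0)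
  have hDwave : ∀ x t, 0 < t → D (x, t) τ τ = ∑ i, D (x, t) (e i) (e i) := by
    intro x t ht
    rw [hD2 x t ht, ← iteratedDeriv_two_slice (hQat x t ht), hwave x t ht,
      laplacian_slice (hQat x t ht)]
  have hGt0 : ∀ x, G (x, 0) τ = 0 := by
    intro x
    have h1 : HasDerivWithinAt (fun s : ℝ => ((x, s) : E d × ℝ)) τ (Ici 0) 0 :=
      (hasDerivAt_const (0 : ℝ) x).hasDerivWithinAt.prodMk (hasDerivWithinAt_id 0 _)
    have h2 := (hQd (x, 0) ⟨mem_univ _, self_mem_Ici⟩).comp_hasDerivWithinAt (0 : ℝ) h1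
      (fun s hs => ⟨mem_univ _, hs⟩)
    exact (uniqueDiffOn_Ici (0 : ℝ) 0 self_mem_Ici).eq_deriv _ h2 (h0' x)
  have hGx0 : ∀ x i, G (x, 0) (e i) = 0 := by
    intro x i
    have h1 : HasFDerivAt (fun y : E d => ((y, 0) : E d × ℝ))
        (ContinuousLinearMap.inl ℝ (E d) ℝ) x := (hasFDerivAt_id x).prodMk (hasFDerivAt_const 0 x)
    have h2 := (hQd (x, 0) ⟨mem_univ _, self_mem_Ici⟩).comp_hasFDerivAt x h1
      (.of_forall fun y => (⟨mem_univ _, self_mem_Ici⟩ : ((y, 0) : E d × ℝ) ∈ H))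
    have h3 : HasFDerivAt (fun y : E d => Q (y, 0)) (0 : E d →L[ℝ] ℝ) x := by
      simp only [h0]; exact hasFDerivAt_const 0 x
    exact DFunLike.congr_fun (h2.unique h3) (EuclideanSpace.single i 1)
  -- inside every backward light cone the time derivative vanishes
  have key : ∀ R x t, 0 < t → 0 < coneDepth R (x, t) → G (x, t) τ = 0 := by
    intro R
    have hχc : Continuous (coneDepth (d := d) R) := continuous_coneDepth R
    have hρc : Continuous fun q : E d × ℝ => coneRadius q.1 :=
      continuous_coneRadius.comp continuous_fst
    have hρ0 : ∀ q : E d × ℝ, coneRadius q.1 ≠ 0 := fun q => (coneRadius_pos _).ne'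
    have hcm : ∀ m, ContinuousOn (fun q => G q m) H := fun m => hGc.clm_apply continuousOn_const
    have hcD : ∀ m n, ContinuousOn (fun q => D q m n) H := fun m n =>
      (hDc.clm_apply continuousOn_const).clm_apply continuousOn_const
    let en : E d × ℝ → ℝ := fun q => G q τ ^ 2 + ∑ i, G q (e i) ^ 2
    have henc : ContinuousOn en H :=
      ((hcm τ).pow 2).add (continuousOn_finsetSum _ fun i _ => (hcm (e i)).pow 2)
    -- `T0` is the time derivative of the weighted energy density, `T i` the derivative along `e i`
    -- of the weighted flux; the wave equation cancels the second derivatives in `2 ∑ T i - T0`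
    let T0 : E d × ℝ → ℝ := fun q => coneDepth R q ^ 2 *
      (2 * G q τ * D q τ τ + ∑ i, 2 * G q (e i) * D q τ (e i)) - 2 * coneDepth R q * en q
    let T : Fin d → E d × ℝ → ℝ := fun i q => coneDepth R q ^ 2 *
      (G q τ * D q (e i) (e i) + G q (e i) * D q (e i) τ) -
      2 * coneDepth R q * (q.1 i / coneRadius q.1) * (G q τ * G q (e i))
    have hT0c : ContinuousOn T0 H := by
      refine ((hχc.continuousOn.pow 2).mul ((((hcm τ).const_mul 2).mul (hcD τ τ)).add
        (continuousOn_finsetSum _ fun i _ => ((hcm (e i)).const_mul 2).mul (hcD τ (e i))))).sub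
        ((hχc.continuousOn.const_mul 2).mul henc)
    have hTc : ∀ i, ContinuousOn (T i) H := by
      intro i
      refine ((hχc.continuousOn.pow 2).mul (((hcm τ).mul (hcD (e i) (e i))).add
        ((hcm (e i)).mul (hcD (e i) τ)))).sub (((hχc.continuousOn.const_mul 2).mul
          (Continuous.continuousOn ?_)).mul ((hcm τ).mul (hcm (e i))))
      exact Continuous.div (by fun_prop) hρc hρ0
    have hGm : ∀ x t, 0 < t → ∀ m, HasFDerivAt (fun q => G q m) ((D (x, t)).flip m) (x, t) := by
      intro x t ht m
      have := (hGder x t ht).clm_apply (hasFDerivAt_const m _)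
      simpa using this
    have hT0z : ∀ q, coneDepth R q = 0 → T0 q = 0 := fun q hq => by simp [T0, hq]
    have hTz : ∀ i q, coneDepth R q = 0 → T i q = 0 := fun i q hq => by simp [T, hq]
    have hint0 : ∫ q in univ ×ˢ Ioi 0, T0 q = 0 := by
      refine setIntegral_time_deriv_eq_zero (R := R) (F := fun q => coneDepth R q ^ 2 * en q)
        ((hχc.continuousOn.pow 2).mul henc) (fun x => ?_) (fun q hq => by simp [hq]) hT0c hT0z ?_
      · simp [en, hGt0, hGx0]
      · intro x t ht
        have h1 : HasDerivAt (fun s : ℝ => ((x, s) : E d × ℝ)) τ t :=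
          (hasDerivAt_const t x).prodMk (hasDerivAt_id t)
        have h2 := (hasFDerivAt_coneDepth_sq R (x, t)).comp_hasDerivAt t h1
        have h3 : ∀ m, HasDerivAt (fun s => G (x, s) m) (D (x, t) τ m) t := fun m =>
          (hGm x t ht m).comp_hasDerivAt t h1
        have h4 := h2.mul (((h3 τ).pow 2).add (HasDerivAt.fun_sum (u := Finset.univ)
          fun i _ => (h3 (e i)).pow 2))
        refine h4.congr_deriv ?_
        simp [T0, en, τ]
        ring
    have hinti : ∀ i, ∫ q in univ ×ˢ Ioi 0, T i q = 0 := by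
      intro i
      refine setIntegral_space_deriv_eq_zero (R := R)
        (F := fun q => coneDepth R q ^ 2 * (G q τ * G q (e i)))
        (EuclideanSpace.single i 1) ((hχc.continuousOn.pow 2).mul ((hcm τ).mul (hcm (e i))))
        (fun q hq => by simp [hq]) (hTc i) (hTz i)
        (F' := fun x t => (coneDepth R (x, t) ^ 2 • (G (x, t) τ • (D (x, t)).flip (e i) +
          G (x, t) (e i) • (D (x, t)).flip τ) + (G (x, t) τ * G (x, t) (e i)) •
          ((2 * coneDepth R (x, t)) • (-ContinuousLinearMap.snd ℝ (E d) ℝ -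
        ((coneRadius x)⁻¹ • innerSL ℝ x).comp (ContinuousLinearMap.fst ℝ (E d) ℝ)))).comp
          (ContinuousLinearMap.inl ℝ (E d) ℝ)) ?_ ?_
      · intro x t ht
        have h1 : HasFDerivAt (fun y : E d => ((y, t) : E d × ℝ))
          (ContinuousLinearMap.inl ℝ (E d) ℝ) x :=
          (hasFDerivAt_id x).prodMk (hasFDerivAt_const t x)
        exact ((hasFDerivAt_coneDepth_sq R (x, t)).mul
          ((hGm x t ht τ).mul (hGm x t ht (e i)))).comp x h1
      · intro x t ht
        simp [T, e, EuclideanSpace.inner_single_right]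
        ring
    let P : E d × ℝ → ℝ := fun q => 2 * coneDepth R q *
      (en q - 2 * G q τ * ∑ i, q.1 i / coneRadius q.1 * G q (e i))
    have hPT : ∀ x t, 0 < t → P (x, t) = 2 * ∑ i, T i (x, t) - T0 (x, t) := by
      intro x t ht
      have e1 : ∑ i, T i (x, t) = coneDepth R (x, t) ^ 2 * (G (x, t) τ * D (x, t) τ τ +
          ∑ i, G (x, t) (e i) * D (x, t) τ (e i)) - 2 * coneDepth R (x, t) * G (x, t) τ *
          ∑ i, x i / coneRadius x * G (x, t) (e i) := by
        rw [hDwave x t ht]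
        simp only [T, Finset.mul_sum, ← Finset.sum_add_distrib, ← Finset.sum_sub_distrib]
        refine Finset.sum_congr rfl fun i _ => ?_
        rw [hsymm x t ht (e i) τ]
        ring
      rw [e1]
      simp only [P, T0, mul_assoc, ← Finset.mul_sum]
      ring
    have hPid : ∀ q, P q = 2 * coneDepth R q *
        (∑ i, (G q (e i) - q.1 i / coneRadius q.1 * G q τ) ^ 2 +
          G q τ ^ 2 * (1 - ∑ i, (q.1 i / coneRadius q.1) ^ 2)) := by
      intro q
      simp only [P, en]
      rw [sum_form_identity]
    have hPnn : ∀ q, 0 ≤ P q := by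
      intro q
      rw [hPid]
      have := sum_sq_div_coneRadius_lt_one q.1
      exact mul_nonneg (mul_nonneg zero_le_two (coneDepth_nonneg R q))
        (add_nonneg (Finset.sum_nonneg fun i _ => sq_nonneg _)
          (mul_nonneg (sq_nonneg _) (by linarith)))
    have hPc : ContinuousOn P H := by
      refine (hχc.continuousOn.const_mul 2).mul (henc.sub (((hcm τ).const_mul 2).mul
        (continuousOn_finsetSum _ fun i _ => (Continuous.continuousOn ?_).mul (hcm (e i)))))
      exact Continuous.div (by fun_prop) hρc hρ0
    have hPint : IntegrableOn P (univ ×ˢ Ioi 0) :=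
      integrableOn_halfSpace (R := R) hPc fun q hq => by simp [P, hq]
    have hmeas : MeasurableSet (univ ×ˢ Ioi 0 : Set (E d × ℝ)) :=
      MeasurableSet.univ.prod measurableSet_Ioi
    have hP0 : ∫ q in univ ×ˢ Ioi 0, P q = 0 := by
      rw [setIntegral_congr_fun (g := fun q => 2 * ∑ i, T i q - T0 q) hmeas
        fun q hq => hPT q.1 q.2 hq.2]
      have hi := fun i => integrableOn_halfSpace (hTc i) (hTz i)
      rw [integral_sub ((integrable_finsetSum _ fun i _ => hi i).const_mul 2)
        (integrableOn_halfSpace hT0c hT0z), integral_const_mul,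
        integral_finsetSum _ fun i _ => hi i, hint0]
      simp [hinti]
    have hae : P =ᵐ[volume.restrict (univ ×ˢ Ioi 0)] fun _ => 0 :=
      (setIntegral_eq_zero_iff_of_nonneg_ae (.of_forall hPnn) hPint).1 hP0
    have heq := Measure.eqOn_open_of_ae_eq hae (isOpen_univ.prod isOpen_Ioi)
      (hPc.mono (prod_mono le_rfl Ioi_subset_Ici_self)) continuousOn_const
    intro x t ht hχ
    have h1 : P (x, t) = 0 := heq ⟨mem_univ _, ht⟩
    rw [hPid] at h1
    have h2 := sum_sq_div_coneRadius_lt_one x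
    have h3 := (mul_eq_zero.1 h1).resolve_left (by positivity)
    have h4 := (add_eq_zero_iff_of_nonneg (Finset.sum_nonneg fun i _ => sq_nonneg _)
      (mul_nonneg (sq_nonneg _) (by simp only; linarith))).1 h3
    have h5 := (mul_eq_zero.1 h4.2).resolve_right (by simp only; linarith)
    exact pow_eq_zero_iff (two_ne_zero) |>.1 h5
  have hder : ∀ s ∈ Ico 0 t, HasDerivWithinAt (fun s => Q (x, s)) 0 (Ici s) s := by
    intro s hs
    rcases hs.1.eq_or_lt with rfl | hs0
    · exact h0' x
    · have h1 : HasDerivAt (fun s : ℝ => ((x, s) : E d × ℝ)) τ s :=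
        (hasDerivAt_const s x).prodMk (hasDerivAt_id s)
      have h2 := (hQder x s hs0).comp_hasDerivAt s h1
      rw [key (s + coneRadius x + 1) x s hs0 (by
        rw [coneDepth, lt_max_iff]; left; simp only; linarith)] at h2
      exact h2.hasDerivWithinAt
  have hcont : ContinuousOn (fun s => Q (x, s)) (Icc 0 t) :=
    hQ.continuousOn.comp (Continuous.continuousOn (by fun_prop)) fun s hs => ⟨mem_univ _, hs.1⟩
  rw [constant_of_has_deriv_right_zero hcont hder t ⟨ht, le_rfl⟩, h0]

/-- Classical solutions of the initial value problem agree for all `t ≥ 0`. -/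
lemma IsWaveSolution.eq {f : E d → ℝ} {p p' : E d → ℝ → ℝ} (hp : IsWaveSolution f p)
    (hp' : IsWaveSolution f p') (x : E d) {t : ℝ} (ht : 0 ≤ t) : p x t = p' x t := by
  rw [← sub_eq_zero]
  have hat : ∀ {p : E d → ℝ → ℝ}, IsWaveSolution f p → ∀ x t, 0 < t →
      ContDiffAt ℝ 2 (fun q : E d × ℝ => p q.1 q.2) (x, t) := fun h x t ht =>
    h.contDiffOn.contDiffAt (prod_mem_nhds univ_mem (Ici_mem_nhds ht))
  refine eq_zero_of_wave (Q := fun q => p q.1 q.2 - p' q.1 q.2)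
    (hp.contDiffOn.sub hp'.contDiffOn) ?_ ?_ ?_ x ht
  · intro x t ht
    have h1 := hp.wave x t ht
    have h2 := hp'.wave x t ht
    have ht1 : ∀ {p : E d → ℝ → ℝ}, IsWaveSolution f p → ContDiffAt ℝ 2 (fun s => p x s) t :=
      fun h => (hat h x t ht).comp t (f := fun s => ((x, s) : E d × ℝ)) (by fun_prop)
    have hx1 : ∀ {p : E d → ℝ → ℝ}, IsWaveSolution f p → ContDiffAt ℝ 2 (fun y => p y t) x :=
      fun h => (hat h x t ht).comp x (f := fun y => ((y, t) : E d × ℝ)) (by fun_prop)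
    have h3 := iteratedDeriv_fun_sub (ht1 hp) (ht1 hp')
    have h4 := (hx1 hp).laplacian_sub (hx1 hp')
    simp only
    rw [h3]
    change _ = Δ ((fun y => p y t) - fun y => p' y t) x
    rw [h4]
    linarith
  · intro x
    simp [hp.initial, hp'.initial]
  · intro x
    have h := (hp.initial_deriv x).fun_sub (hp'.initial_deriv x)
    rwa [sub_zero] at h

lemma pressure_eq {f : E d → ℝ} {p : E d → ℝ → ℝ} (hp : IsWaveSolution f p) (x : E d) {t : ℝ}
    (ht : 0 ≤ t) : pressure f x t = p x t := by
  have h : ∃ p, IsWaveSolution f p := ⟨p, hp⟩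
  rw [pressure, dif_pos h]
  exact h.choose_spec.eq hp x ht

end Energy

/-! ### Fourier representation of the wave -/

section Existence

variable {d : ℕ}

/-- The two sheets of the light cone `τ = ±‖ξ‖` as a measure on space-time frequencies. -/
noncomputable def coneMeasure (d : ℕ) : Measure (E d × ℝ) :=
  Measure.map (fun ξ : E d => (ξ, ‖ξ‖)) volume + Measure.map (fun ξ : E d => (ξ, -‖ξ‖)) volume

/-- The pairing `-(⟨ξ, x⟩ + τ t)` of space-time frequencies with space-time points. -/
noncomputable def conePairing (d : ℕ) : E d × ℝ →L[ℝ] E d × ℝ →L[ℝ] ℝ :=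
  -(((innerSL ℝ : E d →L[ℝ] E d →L[ℝ] ℝ).bilinearComp (ContinuousLinearMap.fst ℝ (E d) ℝ)
      (ContinuousLinearMap.fst ℝ (E d) ℝ) : E d × ℝ →L[ℝ] E d × ℝ →L[ℝ] ℝ) +
    (ContinuousLinearMap.mul ℝ ℝ).bilinearComp (ContinuousLinearMap.snd ℝ (E d) ℝ)
      (ContinuousLinearMap.snd ℝ (E d) ℝ))

lemma conePairing_apply (v w : E d × ℝ) :
    conePairing d v w = -(inner ℝ v.1 w.1 + v.2 * w.2) := by
  simp [conePairing]

lemma integrable_coneMeasure {F : Type*} [NormedAddCommGroup F] {g : E d × ℝ → F}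
    (hg : Continuous g) [SecondCountableTopologyEither (E d × ℝ) F] :
    Integrable g (coneMeasure d) ↔
      Integrable (fun ξ => g (ξ, ‖ξ‖)) ∧ Integrable (fun ξ => g (ξ, -‖ξ‖)) := by
  rw [coneMeasure, integrable_add_measure,
    integrable_map_measure hg.aestronglyMeasurable (by fun_prop),
    integrable_map_measure hg.aestronglyMeasurable (by fun_prop)]
  rfl

lemma ae_coneMeasure : ∀ᵐ v ∂(coneMeasure d), v.2 ^ 2 = ‖v.1‖ ^ 2 := by
  have hm : MeasurableSet {v : E d × ℝ | v.2 ^ 2 = ‖v.1‖ ^ 2} :=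
    (isClosed_eq (by fun_prop) (by fun_prop)).measurableSet
  rw [coneMeasure, ae_add_measure_iff, ae_map_iff (by fun_prop) hm, ae_map_iff (by fun_prop) hm]
  simp

lemma integral_coneMeasure {g : E d × ℝ → ℂ} (hg : Continuous g) (hi : Integrable g (coneMeasure d)) :
    ∫ v, g v ∂(coneMeasure d) = ∫ ξ, (g (ξ, ‖ξ‖) + g (ξ, -‖ξ‖)) := by
  have h := (integrable_coneMeasure hg).1 hi
  rw [integral_add h.1 h.2]
  rw [coneMeasure] at hi ⊢
  rw [integral_add_measure hi.left_of_add_measure hi.right_of_add_measure,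
    integral_map (by fun_prop) hg.aestronglyMeasurable,
    integral_map (by fun_prop) hg.aestronglyMeasurable]

/-- The space-time Fourier integral of a density on the light cone. -/
noncomputable def coneIntegral (H : E d → ℂ) : E d × ℝ → ℂ :=
  VectorFourier.fourierIntegral Real.fourierChar (coneMeasure d) (conePairing d).toLinearMap₁₂
    (fun v => H v.1)

section

variable {H : E d → ℂ} (hc : Continuous H) (hH : ∀ n ≤ 2, Integrable fun ξ => ‖ξ‖ ^ n * ‖H ξ‖)

include hc hH

lemma integrable_coneMeasure_pow {n : ℕ} (hn : n ≤ 2) :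
    Integrable (fun v : E d × ℝ => ‖v‖ ^ n * ‖H v.1‖) (coneMeasure d) := by
  rw [integrable_coneMeasure (by fun_prop)]
  simpa [Prod.norm_def] using hH n hn

lemma contDiff_coneIntegral : ContDiff ℝ 2 (coneIntegral H) := by
  refine VectorFourier.contDiff_fourierIntegral (N := 2) (conePairing d) fun n hn => ?_
  exact integrable_coneMeasure_pow hc hH (by exact_mod_cast hn)

lemma fderiv_fderiv_coneIntegral (w m : E d × ℝ) :
    fderiv ℝ (fderiv ℝ (coneIntegral H)) w m m = ∫ v, (Real.fourierChar (-conePairing d v w) : ℂ) *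
      (-(2 * Real.pi * Complex.I)) ^ 2 * (conePairing d v m : ℂ) ^ 2 * H v.1 ∂(coneMeasure d) := by
  have hint : ∀ n : ℕ, (n : ℕ∞) ≤ 2 →
      Integrable (fun v : E d × ℝ => ‖v‖ ^ n * ‖H v.1‖) (coneMeasure d) :=
    fun n hn => integrable_coneMeasure_pow hc hH (by exact_mod_cast hn)
  have hms : AEStronglyMeasurable (fun v : E d × ℝ => H v.1) (coneMeasure d) :=
    Continuous.aestronglyMeasurable (by fun_prop)
  have h := VectorFourier.iteratedFDeriv_fourierIntegral (N := 2) (conePairing d) hint hms (n := 2)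
    (by norm_num)
  have h2 : fderiv ℝ (fderiv ℝ (coneIntegral H)) w m m =
      iteratedFDeriv ℝ 2 (coneIntegral H) w (fun _ => m) := by
    rw [iteratedFDeriv_two_apply]
  rw [h2, coneIntegral, h, Real.fourierIntegral_continuousMultilinearMap_apply'
    (VectorFourier.integrable_fourierPowSMulRight _
      (integrable_coneMeasure_pow hc hH le_rfl) hms)]
  rw [VectorFourier.fourierIntegral]
  congr 1; ext v
  simp only [VectorFourier.fourierPowSMulRight_apply, Circle.smul_def, smul_eq_mul]
  simp
  ring

/-- The wave equation holds since `τ² = ‖ξ‖²` on the light cone. -/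
lemma coneIntegral_wave (x : E d) (t : ℝ) :
    fderiv ℝ (fderiv ℝ (coneIntegral H)) (x, t) (0, 1) (0, 1) =
      ∑ i, fderiv ℝ (fderiv ℝ (coneIntegral H)) (x, t) (EuclideanSpace.single i 1, 0)
        (EuclideanSpace.single i 1, 0) := by
  simp only [fderiv_fderiv_coneIntegral hc hH]
  rw [← integral_finsetSum]
  · refine integral_congr_ae ?_
    filter_upwards [ae_coneMeasure] with v hv
    rw [← Finset.sum_mul, ← Finset.mul_sum]
    congr 2
    simp only [conePairing_apply, inner_zero_right, EuclideanSpace.inner_single_right]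
    have : ‖v.1‖ ^ 2 = ∑ i, v.1 i ^ 2 := by rw [EuclideanSpace.norm_sq_eq]; simp
    rw [this] at hv
    simp
    exact_mod_cast hv
  · intro i _
    have hb := integrable_coneMeasure_pow hc hH (n := 2) le_rfl
    have hP : Continuous fun v : E d × ℝ => conePairing d v (x, t) := by fun_prop
    have hP' : Continuous fun v : E d × ℝ => conePairing d v (EuclideanSpace.single i 1, 0) := by
      fun_prop
    refine (hb.const_mul ((2 * Real.pi) ^ 2 *
      (‖conePairing d‖ * ‖((EuclideanSpace.single i 1, 0) : E d × ℝ)‖) ^ 2)).mono'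
      (Continuous.aestronglyMeasurable (by fun_prop)) (.of_forall fun v => ?_)
    have h1 := (conePairing d).le_opNorm₂ v (EuclideanSpace.single i 1, 0)
    rw [norm_mul, norm_mul, norm_mul, Circle.norm_coe, norm_pow, norm_pow, Complex.norm_real]
    have h2 : ‖(-(2 * Real.pi * Complex.I) : ℂ)‖ = 2 * Real.pi := by
      simp [abs_of_pos Real.pi_pos]
    rw [h2, one_mul]
    calc _ ≤ (2 * Real.pi) ^ 2 * (‖conePairing d‖ * ‖v‖ *
          ‖((EuclideanSpace.single i 1, 0) : E d × ℝ)‖) ^ 2 * ‖H v.1‖ := by gcongr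
      _ = _ := by ring

lemma coneIntegral_apply (x : E d) (t : ℝ) : coneIntegral H (x, t) =
    2 * 𝓕⁻ (fun ξ => (Real.cos (2 * Real.pi * ‖ξ‖ * t) : ℂ) * H ξ) x := by
  have h0 := integrable_coneMeasure_pow hc hH (n := 0) (by norm_num)
  simp only [pow_zero, one_mul] at h0
  have hP : Continuous fun v : E d × ℝ => conePairing d v (x, t) := by fun_prop
  have hcont : Continuous fun v : E d × ℝ =>
      (Real.fourierChar (-conePairing d v (x, t)) : ℂ) * H v.1 := by fun_prop
  have e1 : coneIntegral H (x, t) =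
    ∫ v, (Real.fourierChar (-conePairing d v (x, t)) : ℂ) * H v.1 ∂(coneMeasure d) := rfl
  rw [e1, integral_coneMeasure hcont (h0.mono' hcont.aestronglyMeasurable
    (.of_forall fun v => by rw [norm_mul, Circle.norm_coe, one_mul])), Real.fourierInv_eq,
    ← integral_const_mul]
  congr 1; ext ξ
  simp only [Circle.smul_def, smul_eq_mul, conePairing_apply, neg_neg, Real.fourierChar_apply,
    Complex.ofReal_cos, Complex.cos]
  push_cast
  have e2 : ∀ a b : ℂ, Complex.exp (2 * Real.pi * (a + b) * Complex.I) =
      Complex.exp (2 * Real.pi * a * Complex.I) * Complex.exp (2 * Real.pi * b * Complex.I) := by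
    intro a b; rw [← Complex.exp_add]; congr 1; ring
  rw [e2, e2]
  rw [show (2 * Real.pi * (‖ξ‖ * t) * Complex.I : ℂ) = 2 * Real.pi * ‖ξ‖ * t * Complex.I by ring,
    show (2 * Real.pi * (-‖ξ‖ * t) * Complex.I : ℂ) = -(2 * Real.pi * ‖ξ‖ * t) * Complex.I by ring]
  ring

lemma isWaveSolution_coneIntegral {h : E d → ℝ} (hh : ∀ x, (h x : ℂ) = 𝓕⁻ H x) :
    IsWaveSolution h (fun x t =>
      (𝓕⁻ (fun ξ => (Real.cos (2 * Real.pi * ‖ξ‖ * t) : ℂ) * H ξ) x).re) := by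
  set P : E d × ℝ → ℝ := fun q => (1 / 2 : ℝ) * (coneIntegral H q).re with hP
  have hPeq : ∀ x t, (𝓕⁻ (fun ξ => (Real.cos (2 * Real.pi * ‖ξ‖ * t) : ℂ) * H ξ) x).re =
      P (x, t) := by
    intro x t
    simp only [hP, coneIntegral_apply hc hH]
    simp
  simp only [hPeq]
  have hZ := contDiff_coneIntegral hc hH
  have hP2 : ContDiff ℝ 2 P := contDiff_const.mul (Complex.reCLM.contDiff.comp hZ)
  have hD : ∀ q m, fderiv ℝ (fderiv ℝ P) q m m =
      1 / 2 * (fderiv ℝ (fderiv ℝ (coneIntegral H)) q m m).re := by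
    intro q m
    let ℓ : ℂ →L[ℝ] ℝ := (1 / 2 : ℝ) • Complex.reCLM
    have e1 : P = ℓ ∘ coneIntegral H := by ext q; simp [ℓ, hP]
    have e2 := ℓ.iteratedFDeriv_comp_left (x := q) (i := 2) hZ.contDiffAt (by norm_num)
    have e3 := congrArg (fun T => T (fun _ => m)) e2
    simp only [← e1, iteratedFDeriv_two_apply, ContinuousLinearMap.compContinuousMultilinearMap_coe,
      Function.comp_apply] at e3
    rw [e3]
    simp [ℓ]
  have hdiff : ∀ x, DifferentiableAt ℝ (fun s => P (x, s)) 0 := fun x =>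
    ((hP2.differentiable (by norm_num)).comp
      ((differentiable_const x).prodMk differentiable_id)).differentiableAt
  refine ⟨hP2.contDiffOn, ?_, ?_, ?_⟩
  · intro x t _
    rw [iteratedDeriv_two_slice hP2.contDiffAt, laplacian_slice hP2.contDiffAt, sub_eq_zero]
    simp only [hD, ← Finset.mul_sum, ← Complex.re_sum]
    rw [coneIntegral_wave hc hH]
  · intro x
    rw [← hPeq]
    simp [← hh]
  · intro x
    -- the solution is even in time
    have heven : (fun s => P (x, -s)) = fun s => P (x, s) := by
      ext s
      simp only [← hPeq]
      simp
    have h1 := deriv_comp_neg (fun s => P (x, s)) 0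
    rw [heven, neg_zero] at h1
    have h2 : deriv (fun s => P (x, s)) 0 = 0 := by linarith
    have h3 := (hdiff x).hasDerivAt
    rw [h2] at h3
    exact h3.hasDerivWithinAt

/-- The pressure with initial value `h = 𝓕⁻ H` is the inverse Fourier integral of
`cos(2π‖ξ‖t) H(ξ)`. -/
lemma pressure_eq_fourierInv {h : E d → ℝ} (hh : ∀ x, (h x : ℂ) = 𝓕⁻ H x) (x : E d) {t : ℝ}
    (ht : 0 ≤ t) : pressure h x t =
      (𝓕⁻ (fun ξ => (Real.cos (2 * Real.pi * ‖ξ‖ * t) : ℂ) * H ξ) x).re :=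
  pressure_eq (isWaveSolution_coneIntegral hc hH hh) x ht

end

end Existence

/-! ### Temporal filters and the factorization in the Fourier domain -/

section TemporalFilters

/-- The Fourier transform of an even function on the line, `∫ v(s) cos(2πρs) ds`. -/
noncomputable def cosTransform (v : ℝ → ℝ) (ρ : ℝ) : ℝ :=
  ∫ s, v s * Real.cos (2 * Real.pi * ρ * s)

variable {v : ℝ → ℝ}

lemma integrable_mul_of_abs_le_one {g : ℝ → ℝ} (hv : Integrable v) (hg : Continuous g)
    (h1 : ∀ s, |g s| ≤ 1) : Integrable fun s => v s * g s :=
  hv.mul_bdd (c := 1) hg.aestronglyMeasurable (.of_forall fun s => by simpa using h1 s)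

lemma integral_mul_sin_eq_zero (heven : ∀ s, v (-s) = v s) (ρ : ℝ) :
    ∫ s, v s * Real.sin (2 * Real.pi * ρ * s) = 0 := by
  have h := integral_neg_eq_self (fun s => v s * Real.sin (2 * Real.pi * ρ * s)) volume
  simp only [heven, mul_neg, Real.sin_neg, integral_neg] at h
  linarith

lemma integral_mul_cos_sub (hv : Integrable v) (heven : ∀ s, v (-s) = v s) (ρ t : ℝ) :
    ∫ s, v s * Real.cos (2 * Real.pi * ρ * (t - s)) =
      Real.cos (2 * Real.pi * ρ * t) * cosTransform v ρ := by
  have hsin := integral_mul_sin_eq_zero heven ρ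
  have e : ∀ s, v s * Real.cos (2 * Real.pi * ρ * (t - s)) =
      Real.cos (2 * Real.pi * ρ * t) * (v s * Real.cos (2 * Real.pi * ρ * s)) +
        Real.sin (2 * Real.pi * ρ * t) * (v s * Real.sin (2 * Real.pi * ρ * s)) := by
    intro s
    rw [mul_sub, Real.cos_sub]; ring
  simp only [e]
  rw [integral_add, integral_const_mul, integral_const_mul, hsin, cosTransform]
  · simp
  · exact (integrable_mul_of_abs_le_one hv (by fun_prop) fun s => Real.abs_cos_le_one _).const_mul _
  · exact (integrable_mul_of_abs_le_one hv (by fun_prop) fun s => Real.abs_sin_le_one _).const_mul _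

lemma abs_cosTransform_le (hv : Integrable v) (ρ : ℝ) : |cosTransform v ρ| ≤ ∫ s, |v s| := by
  refine (abs_integral_le_integral_abs).trans (integral_mono_of_nonneg
    (.of_forall fun _ => abs_nonneg _) hv.abs (.of_forall fun s => ?_))
  simp only [abs_mul]
  exact mul_le_of_le_one_right (abs_nonneg _) (Real.abs_cos_le_one _)

lemma continuous_cosTransform (hv : Integrable v) : Continuous (cosTransform v) := by
  refine continuous_of_dominated (bound := fun s => |v s|) (fun ρ => ?_) (fun ρ => ?_) hv.abs
    (.of_forall fun s => by fun_prop)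
  · exact (integrable_mul_of_abs_le_one hv (by fun_prop) fun s =>
      Real.abs_cos_le_one _).aestronglyMeasurable
  · refine .of_forall fun s => ?_
    rw [Real.norm_eq_abs, abs_mul]
    exact mul_le_of_le_one_right (abs_nonneg _) (Real.abs_cos_le_one _)

variable {d : ℕ} {H : E d → ℂ} {h : E d → ℝ}

lemma evenExt_pressure (hc : Continuous H) (hH : ∀ n ≤ 2, Integrable fun ξ => ‖ξ‖ ^ n * ‖H ξ‖)
    (hh : ∀ x, (h x : ℂ) = 𝓕⁻ H x) (z : E d) (τ : ℝ) : evenExt (pressure h z) τ =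
      (𝓕⁻ (fun ξ => (Real.cos (2 * Real.pi * ‖ξ‖ * τ) : ℂ) * H ξ) z).re := by
  rw [evenExt, pressure_eq_fourierInv hc hH hh z (abs_nonneg τ)]
  have : ∀ ξ : E d, Real.cos (2 * Real.pi * ‖ξ‖ * |τ|) = Real.cos (2 * Real.pi * ‖ξ‖ * τ) := by
    intro ξ
    rcases abs_choice τ with h | h <;> rw [h]
    rw [mul_neg, Real.cos_neg]
  simp only [this]

lemma integrable_of_weighted (hc : Continuous H)
    (hH : ∀ n ≤ 2, Integrable fun ξ => ‖ξ‖ ^ n * ‖H ξ‖) : Integrable H := by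
  have := hH 0 (by norm_num)
  simp only [pow_zero, one_mul] at this
  exact (integrable_norm_iff hc.aestronglyMeasurable).1 this

lemma continuous_evenExt_pressure (hc : Continuous H)
    (hH : ∀ n ≤ 2, Integrable fun ξ => ‖ξ‖ ^ n * ‖H ξ‖)
    (hh : ∀ x, (h x : ℂ) = 𝓕⁻ H x) (z : E d) : Continuous (evenExt (pressure h z)) := by
  have h1 : evenExt (pressure h z) = fun τ => (1 / 2 : ℝ) * (coneIntegral H (z, τ)).re := by
    ext τ
    rw [evenExt_pressure hc hH hh, coneIntegral_apply hc hH]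
    simp
  rw [h1]
  have := (contDiff_coneIntegral hc hH).continuous
  fun_prop

lemma abs_evenExt_pressure_le (hc : Continuous H)
    (hH : ∀ n ≤ 2, Integrable fun ξ => ‖ξ‖ ^ n * ‖H ξ‖)
    (hh : ∀ x, (h x : ℂ) = 𝓕⁻ H x) (z : E d) (τ : ℝ) :
    |evenExt (pressure h z) τ| ≤ ∫ ξ, ‖H ξ‖ := by
  rw [evenExt_pressure hc hH hh]
  refine (Complex.abs_re_le_norm _).trans ((norm_fourierInv_le _ _).trans ?_)
  refine integral_mono_of_nonneg (.of_forall fun _ => norm_nonneg _)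
    (integrable_of_weighted hc hH).norm (.of_forall fun ξ => ?_)
  simp only [norm_mul, Complex.norm_real, Real.norm_eq_abs]
  exact mul_le_of_le_one_left (norm_nonneg _) (Real.abs_cos_le_one _)

/-- A temporal filter acts on the trace of a wave by multiplying the spatial spectral density by
the Fourier transform of the filter at `‖ξ‖`. -/
lemma timeConv_pressure (hc : Continuous H) (hH : ∀ n ≤ 2, Integrable fun ξ => ‖ξ‖ ^ n * ‖H ξ‖)
    (hh : ∀ x, (h x : ℂ) = 𝓕⁻ H x) (hv : Integrable v) (heven : ∀ s, v (-s) = v s)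
    (z : E d) (t : ℝ) : timeConv v (pressure h z) t =
      (𝓕⁻ (fun ξ => (Real.cos (2 * Real.pi * ‖ξ‖ * t) : ℂ) *
        ((cosTransform v ‖ξ‖ : ℂ) * H ξ)) z).re := by
  have hHi := integrable_of_weighted hc hH
  let K : ℝ → E d → ℂ := fun s ξ => (v s : ℂ) * ((Real.fourierChar (inner ℝ ξ z) : ℂ) *
    ((Real.cos (2 * Real.pi * ‖ξ‖ * (t - s)) : ℂ) * H ξ))
  have hK : Integrable (Function.uncurry K) (volume.prod volume) := by
    have h1 : Integrable (fun p : ℝ × E d => (v p.1 : ℂ) * H p.2) (volume.prod volume) :=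
      hv.ofReal.mul_prod hHi
    have h2 := h1.bdd_mul (c := 1) (f := fun p : ℝ × E d => (Real.fourierChar (inner ℝ p.2 z) : ℂ) *
      (Real.cos (2 * Real.pi * ‖p.2‖ * (t - p.1)) : ℂ))
      (Continuous.aestronglyMeasurable (by fun_prop)) (.of_forall fun p => by
        rw [norm_mul, Circle.norm_coe, one_mul, Complex.norm_real]
        exact Real.abs_cos_le_one _)
    refine h2.congr (.of_forall fun p => ?_)
    simp only [Function.uncurry, K]
    ring
  have e1 : timeConv v (pressure h z) t = (∫ s, ∫ ξ, K s ξ).re := by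
    rw [timeConv, conv, convolution_def]
    simp only [ContinuousLinearMap.mul_apply']
    rw [← Complex.ofReal_re (∫ s, _), ← integral_complex_ofReal]
    have : ∀ s, ∫ ξ, K s ξ = (v s : ℂ) *
        𝓕⁻ (fun ξ => (Real.cos (2 * Real.pi * ‖ξ‖ * (t - s)) : ℂ) * H ξ) z := by
      intro s
      simp only [K]
      rw [integral_const_mul, Real.fourierInv_eq]
      simp only [Circle.smul_def, smul_eq_mul]
    have hre : ∫ s, ((∫ ξ, K s ξ).re : ℂ) = ((∫ s, ∫ ξ, K s ξ).re : ℂ) := by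
      rw [integral_complex_ofReal]
      congr 1
      exact integral_re hK.integral_prod_left
    rw [← Complex.ofReal_re (∫ s, ∫ ξ, K s ξ).re, ← hre]
    congr 2; ext s
    rw [this, evenExt_pressure hc hH hh, Complex.re_ofReal_mul]
  rw [e1, integral_integral_swap hK, Real.fourierInv_eq]
  congr 2; ext ξ
  have e2 : ∀ s, K s ξ = ((v s * Real.cos (2 * Real.pi * ‖ξ‖ * (t - s)) : ℝ) : ℂ) *
      ((Real.fourierChar (inner ℝ ξ z) : ℂ) * H ξ) := by
    intro s; simp only [K]; push_cast; ring
  simp only [e2]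
  rw [integral_mul_const, integral_complex_ofReal, integral_mul_cos_sub hv heven]
  simp only [Circle.smul_def, smul_eq_mul]
  push_cast
  ring

/-- There are test functions whose Fourier transform does not vanish at a given frequency. -/
lemma exists_testFourier_ne_zero (ξ : E d) :
    ∃ (f : E d → ℝ) (hf : ContDiff ℝ ∞ f) (hc : HasCompactSupport f), testFourier hf hc ξ ≠ 0 := by
  -- on a ball of this radius the phase `2π⟨x, ξ⟩` is smaller than `π / 2`
  let r : ℝ := 1 / (8 * (‖ξ‖ + 1))
  have hr : 0 < r := by positivity
  let φ : ContDiffBump (0 : E d) := ⟨r / 2, r, by positivity, by linarith⟩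
  refine ⟨φ, φ.contDiff, φ.hasCompactSupport, fun h0 => ?_⟩
  rw [testFourier_apply, Real.fourier_eq] at h0
  have hi : Integrable (fun x => (φ x : ℂ)) := φ.integrable.ofReal
  have h1 : ∫ x, φ x * Real.cos (2 * Real.pi * inner ℝ x ξ) = 0 := by
    rw [← Complex.zero_re, ← h0]
    have h2 := integral_re ((Real.fourierIntegral_convergent_iff ξ).2 hi)
    refine Eq.trans ?_ h2
    congr 1; ext x
    simp [Circle.smul_def, Real.fourierChar_apply, Complex.exp_re]
    ring
  refine h1.not_gt (Continuous.integral_pos_of_hasCompactSupport_nonneg_nonzero (x := 0)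
    (by have := φ.continuous; fun_prop) φ.hasCompactSupport.mul_right (fun x => ?_) ?_)
  · change 0 ≤ φ x * Real.cos (2 * Real.pi * inner ℝ x ξ)
    by_cases hx : x ∈ Metric.ball (0 : E d) r
    · refine mul_nonneg φ.nonneg (Real.cos_nonneg_of_mem_Icc ?_)
      rw [mem_ball_zero_iff] at hx
      have h3 : |inner ℝ x ξ| ≤ 1 / 8 := by
        refine (abs_real_inner_le_norm x ξ).trans ?_
        calc ‖x‖ * ‖ξ‖ ≤ r * (‖ξ‖ + 1) := by gcongr; linarith
          _ = 1 / 8 := by simp only [r]; field_simp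
      obtain ⟨h4, h5⟩ := abs_le.1 h3
      constructor <;> nlinarith [Real.pi_pos]
    · have : φ x = 0 := φ.zero_of_le_dist (by simpa [φ] using hx)
      simp [this]
  · have : φ 0 = 1 := φ.one_of_mem_closedBall (Metric.mem_closedBall_self φ.rIn_pos.le)
    simp [this]

lemma integrable_weighted_testFourier {f : E d → ℝ} (hf : ContDiff ℝ ∞ f)
    (hc : HasCompactSupport f) (n : ℕ) : Integrable fun ξ => ‖ξ‖ ^ n * ‖testFourier hf hc ξ‖ :=
  (testFourier hf hc).integrable_pow_mul volume n

lemma integrable_weighted_mul_testFourier {f : E d → ℝ} (hf : ContDiff ℝ ∞ f)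
    (hc : HasCompactSupport f) {m : E d → ℂ} (hm : Continuous m) {C : ℝ} (hC : ∀ ξ, ‖m ξ‖ ≤ C)
    (n : ℕ) : Integrable fun ξ => ‖ξ‖ ^ n * ‖m ξ * testFourier hf hc ξ‖ := by
  refine ((integrable_weighted_testFourier hf hc n).const_mul C).mono'
    (Continuous.aestronglyMeasurable (by fun_prop)) (.of_forall fun ξ => ?_)
  rw [norm_mul, norm_pow, norm_norm, norm_norm, norm_mul]
  calc _ ≤ ‖ξ‖ ^ n * (C * ‖testFourier hf hc ξ‖) := by gcongr; exact hC ξ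
    _ = _ := by ring

/-- If a spatial and a temporal filter are intertwined by the wave equation at one detector, then
the spatial filter has the radial Fourier transform `v̂(‖ξ‖)`. -/
lemma fourier_eq_cosTransform {u : E d → ℝ} (hu : Integrable u) (hv : Integrable v)
    (heven : ∀ s, v (-s) = v s) (z : E d)
    (hcomm : ∀ f : E d → ℝ, ContDiff ℝ ∞ f → HasCompactSupport f → ∀ t, 0 < t →
      pressure (conv u f) z t = timeConv v (pressure f z) t) (ξ : E d) :
    𝓕 (fun x => (u x : ℂ)) ξ = cosTransform v ‖ξ‖ := by
  have hu' : Integrable (fun x => (u x : ℂ)) := hu.ofReal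
  let m : E d → ℂ := fun ξ => 𝓕 (fun x => (u x : ℂ)) ξ - cosTransform v ‖ξ‖
  have hVc : Continuous fun ξ : E d => (cosTransform v ‖ξ‖ : ℂ) :=
    Complex.continuous_ofReal.comp ((continuous_cosTransform hv).comp continuous_norm)
  have hVb : ∀ ξ : E d, ‖(cosTransform v ‖ξ‖ : ℂ)‖ ≤ ∫ s, |v s| := fun ξ => by
    rw [Complex.norm_real]; exact abs_cosTransform_le hv _
  have huc := continuous_fourier hu'
  have hub := norm_fourier_le (fun x => (u x : ℂ))
  have hmc : Continuous m := huc.sub hVc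
  have hmb : ∀ ξ, ‖m ξ‖ ≤ (∫ x, ‖(u x : ℂ)‖) + ∫ s, |v s| := fun ξ =>
    (norm_sub_le _ _).trans (add_le_add (hub ξ) (hVb ξ))
  have hmsymm : ∀ ξ, m (-ξ) = starRingEnd ℂ (m ξ) := by
    intro ξ
    simp only [m, fourier_neg_of_real, norm_neg, map_sub, Complex.conj_ofReal]
  -- at the detector the weighted spectral density integrates to zero
  have key : ∀ (f : E d → ℝ) (hf : ContDiff ℝ ∞ f) (hc : HasCompactSupport f),
      𝓕⁻ (fun ξ => m ξ * testFourier hf hc ξ) z = 0 := by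
    intro f hf hc
    set H : E d → ℂ := ⇑(testFourier hf hc) with hH
    have hHc : Continuous H := (testFourier hf hc).continuous
    have hHw : ∀ n ≤ 2, Integrable fun ξ => ‖ξ‖ ^ n * ‖H ξ‖ := fun n _ =>
      integrable_weighted_testFourier hf hc n
    have hHi := integrable_of_weighted hHc hHw
    have hconv : ∀ x, ((conv u f x : ℝ) : ℂ) = 𝓕⁻ (fun ξ => 𝓕 (fun x => (u x : ℂ)) ξ * H ξ) x :=
      ofReal_conv hu hHi (ofReal_eq_fourierInv hf hc)
    have hKc : Continuous fun ξ => m ξ * H ξ := hmc.mul hHc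
    have hKw : ∀ n ≤ 2, Integrable fun ξ => ‖ξ‖ ^ n * ‖m ξ * H ξ‖ := fun n _ =>
      integrable_weighted_mul_testFourier hf hc hmc hmb n
    have hpos : ∀ t, 0 < t → (coneIntegral (fun ξ => m ξ * H ξ) (z, t)).re = 0 := by
      intro t ht
      have h1 := hcomm f hf hc t ht
      rw [pressure_eq_fourierInv (huc.mul hHc)
        (fun n _ => integrable_weighted_mul_testFourier hf hc huc hub n) hconv z ht.le,
        timeConv_pressure hHc hHw (ofReal_eq_fourierInv hf hc) hv heven, ← sub_eq_zero,
        ← Complex.sub_re] at h1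
      simp only [Pi.mul_apply] at h1
      rw [coneIntegral_apply hKc hKw]
      have hi1 : Integrable fun ξ => 𝓕 (fun x => (u x : ℂ)) ξ * H ξ :=
        integrable_fourier_mul hu' hHi
      have hi2 : Integrable fun ξ : E d => (cosTransform v ‖ξ‖ : ℂ) * H ξ :=
        hHi.bdd_mul hVc.aestronglyMeasurable (.of_forall hVb)
      have hcos : ∀ g : E d → ℂ, Integrable g →
          Integrable fun ξ => (Real.cos (2 * Real.pi * ‖ξ‖ * t) : ℂ) * g ξ := fun g hg =>
        hg.bdd_mul (c := 1) (Continuous.aestronglyMeasurable (by fun_prop))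
          (.of_forall fun ξ => by rw [Complex.norm_real]; exact Real.abs_cos_le_one _)
      have e : 𝓕⁻ (fun ξ => (Real.cos (2 * Real.pi * ‖ξ‖ * t) : ℂ) * (m ξ * H ξ)) z =
          𝓕⁻ (fun ξ => (Real.cos (2 * Real.pi * ‖ξ‖ * t) : ℂ) *
            (𝓕 (fun x => (u x : ℂ)) ξ * H ξ)) z -
          𝓕⁻ (fun ξ => (Real.cos (2 * Real.pi * ‖ξ‖ * t) : ℂ) *
            ((cosTransform v ‖ξ‖ : ℂ) * H ξ)) z := by
        simp only [Real.fourierInv_eq, Circle.smul_def, smul_eq_mul]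
        rw [← integral_sub (integrable_fourierChar_mul (hcos _ hi1) z)
          (integrable_fourierChar_mul (hcos _ hi2) z)]
        congr 1; ext ξ; simp only [m]; ring
      rw [e, Complex.mul_re, h1]
      simp
    have hcontt : Continuous fun t : ℝ => (coneIntegral (fun ξ => m ξ * H ξ) (z, t)).re := by
      have := (contDiff_coneIntegral hKc hKw).continuous
      fun_prop
    have hzero : (coneIntegral (fun ξ => m ξ * H ξ) (z, 0)).re = 0 := by
      have h1 : Tendsto (fun t : ℝ => (coneIntegral (fun ξ => m ξ * H ξ) (z, t)).re) (𝓝[>] 0)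
          (𝓝 (coneIntegral (fun ξ => m ξ * H ξ) (z, 0)).re) :=
        hcontt.continuousAt.continuousWithinAt
      refine tendsto_nhds_unique h1 (tendsto_const_nhds.congr' ?_)
      filter_upwards [self_mem_nhdsWithin] with t ht
      exact (hpos t ht).symm
    rw [coneIntegral_apply hKc hKw] at hzero
    simp only [mul_zero, Real.cos_zero, Complex.ofReal_one, one_mul] at hzero
    refine Complex.ext (by simpa using hzero) (fourierInv_im_eq_zero (fun ξ => ?_) z)
    rw [hmsymm, map_mul]
    congr 1
    exact fourier_neg_of_real f ξ
  obtain ⟨f, hf, hc, hne⟩ := exists_testFourier_ne_zero ξ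
  -- translating the test function turns the detector into an arbitrary point
  have hall : ∀ x, 𝓕⁻ (fun ξ => m ξ * testFourier hf hc ξ) x = 0 := by
    intro x
    have hf' : ContDiff ℝ ∞ fun y => f (y + (x - z)) := hf.comp (contDiff_id.add contDiff_const)
    have hc' : HasCompactSupport fun y => f (y + (x - z)) :=
      hc.comp_homeomorph (Homeomorph.addRight (x - z))
    rw [← key _ hf' hc', Real.fourierInv_eq, Real.fourierInv_eq]
    congr 1; ext η
    have h1 := congrFun (VectorFourier.fourierIntegral_comp_add_right Real.fourierChar volume
      (innerₗ (E d)) (fun y => (f y : ℂ)) (x - z)) η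
    have h2 : testFourier hf' hc' η = (Real.fourierChar (inner ℝ (x - z) η) : ℂ) *
      testFourier hf hc η := h1
    rw [h2, inner_sub_left, sub_eq_add_neg, AddChar.map_add_eq_mul, AddChar.map_neg_eq_inv,
      real_inner_comm x η, real_inner_comm z η]
    simp only [Circle.smul_def, smul_eq_mul, Circle.coe_mul, Circle.coe_inv]
    field_simp
  have hKc : Continuous fun ξ => m ξ * testFourier hf hc ξ :=
    hmc.mul (testFourier hf hc).continuous
  have hKi : Integrable fun ξ => m ξ * testFourier hf hc ξ :=
    integrable_of_weighted hKc fun n _ => integrable_weighted_mul_testFourier hf hc hmc hmb n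
  have hall' : 𝓕 (fun ξ => m ξ * testFourier hf hc ξ) = fun _ => 0 := by
    ext x
    rw [← neg_neg x, ← Real.fourierInv_eq_fourier_neg, hall]
  have hinv := hKc.fourierInv_fourier_eq hKi (by rw [hall']; exact integrable_zero _ _ _)
  have hz : m ξ * testFourier hf hc ξ = 0 := by
    rw [← congrFun hinv ξ, hall', Real.fourierInv_eq]
    simp
  exact sub_eq_zero.1 ((mul_eq_zero.1 hz).resolve_right hne)

end TemporalFilters

/-! ### Taylor polynomials in the squared variable -/

section RadialDerivatives

variable {v : ℝ → ℝ} {k : ℕ}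

lemma contDiffOn_radialDeriv_iterate (hv : ContDiffOn ℝ k v (Ioi 0)) :
    ∀ i n : ℕ, i + n = k → ContDiffOn ℝ n (radialDeriv^[i] v) (Ioi 0) := by
  intro i
  induction i with
  | zero => intro n hn; simpa [← hn] using hv
  | succ i ih =>
    intro n hn
    have h1 := (ih (n + 1) (by omega)).deriv_of_isOpen (m := n) isOpen_Ioi (by norm_num)
    rw [Function.iterate_succ_apply']
    refine ContDiffOn.mul (ContDiffOn.div contDiffOn_const (by fun_prop) fun t ht => ?_) h1
    have : (0 : ℝ) < t := ht
    positivity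

/-- The radial derivative is the derivative with respect to `t²`. -/
lemma hasDerivAt_radialDeriv_iterate (hv : ContDiffOn ℝ k v (Ioi 0)) {i : ℕ} (hi : i < k) {t : ℝ}
    (ht : 0 < t) : HasDerivAt (radialDeriv^[i] v) (2 * t * (radialDeriv^[i + 1] v) t) t := by
  have h1 := contDiffOn_radialDeriv_iterate hv i (k - i) (by omega)
  have h2 : DifferentiableAt ℝ (radialDeriv^[i] v) t :=
    (h1.differentiableOn (by exact_mod_cast (by omega : k - i ≠ 0))).differentiableAt
      (Ioi_mem_nhds ht)
  refine h2.hasDerivAt.congr_deriv ?_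
  rw [Function.iterate_succ_apply', radialDeriv]
  field_simp

lemma continuousOn_radialDeriv_iterate (hv : ContDiffOn ℝ k v (Ioi 0)) :
    ContinuousOn (radialDeriv^[k] v) (Ioi 0) :=
  (contDiffOn_radialDeriv_iterate hv k 0 (by omega)).continuousOn

/-- The Taylor polynomial at `t²` of `v`, as a function of the squared variable. -/
noncomputable def sqTaylor (v : ℝ → ℝ) (n : ℕ) (t : ℝ) : Polynomial ℝ :=
  ∑ i ∈ Finset.range n, Polynomial.C ((radialDeriv^[i] v) t / i.factorial) *
    (Polynomial.X - Polynomial.C (t ^ 2)) ^ i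

lemma eval_sqTaylor (v : ℝ → ℝ) (n : ℕ) (t σ : ℝ) : (sqTaylor v n t).eval σ =
    ∑ i ∈ Finset.range n, (radialDeriv^[i] v) t * (σ - t ^ 2) ^ i / i.factorial := by
  simp only [sqTaylor, Polynomial.eval_finsetSum, Polynomial.eval_mul, Polynomial.eval_C,
    Polynomial.eval_pow, Polynomial.eval_sub, Polynomial.eval_X]
  exact Finset.sum_congr rfl fun i _ => by ring

lemma degree_sqTaylor_lt (v : ℝ → ℝ) (n : ℕ) (t : ℝ) : (sqTaylor v n t).degree < n := by
  refine Polynomial.mem_degreeLT.1 (Submodule.sum_mem _ fun i hi => Polynomial.mem_degreeLT.2 ?_)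
  rw [← Polynomial.smul_eq_C_mul]
  refine (Polynomial.degree_smul_le _ _).trans_lt ?_
  rw [Polynomial.degree_pow, Polynomial.degree_X_sub_C]
  simpa using hi

lemma hasDerivAt_eval_sqTaylor (hv : ContDiffOn ℝ k v (Ioi 0)) (σ : ℝ) {t : ℝ} (ht : 0 < t) :
    ∀ n, n < k → HasDerivAt (fun t => (sqTaylor v (n + 1) t).eval σ)
      (2 * t * (radialDeriv^[n + 1] v) t * (σ - t ^ 2) ^ n / n.factorial) t := by
  intro n
  simp only [eval_sqTaylor]
  induction n with
  | zero =>
    intro hn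
    simpa using hasDerivAt_radialDeriv_iterate hv hn ht
  | succ n ih =>
    intro hn
    simp only [Finset.sum_range_succ _ (n + 1)]
    have h1 := hasDerivAt_radialDeriv_iterate hv hn ht
    have h2 : HasDerivAt (fun t : ℝ => (σ - t ^ 2) ^ (n + 1))
        (((n + 1 : ℕ) : ℝ) * (σ - t ^ 2) ^ n * (-(2 * t))) t := by
      simpa using ((hasDerivAt_pow 2 t).const_sub σ).fun_pow (n + 1)
    refine ((ih (by omega)).add ((h1.mul h2).div_const ((n + 1).factorial : ℝ))).congr_deriv ?_
    rw [Nat.factorial_succ]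
    push_cast
    have : (n.factorial : ℝ) ≠ 0 := by positivity
    have : (n : ℝ) + 1 ≠ 0 := by positivity
    field_simp
    ring

end RadialDerivatives

/-! ### Recovering a filter from its radial derivative -/

section Representation

lemma exists_eventually_le_abs_eval {P : Polynomial ℝ} (hP : P ≠ 0) :
    ∃ c > 0, ∀ᶠ σ in atTop, c ≤ |P.eval σ| := by
  by_cases hdeg : 0 < P.degree
  · exact ⟨1, one_pos, (P.abs_tendsto_atTop hdeg).eventually_ge_atTop 1⟩
  · rw [not_lt, Polynomial.degree_le_zero_iff] at hdeg
    refine ⟨|P.coeff 0|, ?_, ?_⟩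
    · rw [gt_iff_lt, abs_pos]
      intro h; rw [h] at hdeg; exact hP (by simpa using hdeg)
    · rw [hdeg]; simp

variable {v : ℝ → ℝ} {k : ℕ}

/-- A pointwise limit of polynomials of bounded degree is a polynomial, by Lagrange
interpolation. -/
lemma exists_polynomial_of_tendsto {ι : Type*} {l : Filter ι} [l.NeBot] {P : ι → Polynomial ℝ}
    (n : ℕ) (hP : ∀ i, (P i).degree < n) {q : ℝ → ℝ}
    (hq : ∀ σ, 0 < σ → Tendsto (fun i => (P i).eval σ) l (𝓝 (q σ))) :
    ∃ Q : Polynomial ℝ, ∀ σ, 0 < σ → q σ = Q.eval σ := by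
  let node : ℕ → ℝ := fun i => i + 1
  have hinj : InjOn node (Finset.range n) := fun i _ j _ h => by simpa [node] using h
  refine ⟨Lagrange.interpolate (Finset.range n) node fun i => q (node i), fun σ hσ => ?_⟩
  have h1 : ∀ i, (P i).eval σ = ∑ j ∈ Finset.range n,
      (P i).eval (node j) * (Lagrange.basis (Finset.range n) node j).eval σ := by
    intro i
    conv_lhs => rw [Lagrange.eq_interpolate (f := P i) hinj (by simpa using hP i)]
    simp [Lagrange.interpolate_apply, Polynomial.eval_finsetSum]
  refine tendsto_nhds_unique (hq σ hσ) ?_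
  simp only [h1, Lagrange.interpolate_apply, Polynomial.eval_finsetSum, Polynomial.eval_mul,
    Polynomial.eval_C]
  exact tendsto_finsetSum _ fun j _ => (hq (node j) (by simp only [node]; positivity)).mul_const _

/-- A filter is recovered from its `k`-th radial derivative by iterated integration from infinity:
the difference is a polynomial in `s²`, which vanishes since `v` is integrable. -/
lemma eq_neg_integral_radialDeriv (hv : ContDiffOn ℝ (k + 1 : ℕ) v (Ioi 0))
    (hdecay : IntegrableOn (fun t => t ^ (2 * (k + 1)) * (radialDeriv^[k + 1] v) t) (Ioi 0))
    (hint : Integrable v) {s : ℝ} (hs : 0 < s) :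
    v s = -∫ t in Ioi s, 2 * t * (radialDeriv^[k + 1] v) t * (s ^ 2 - t ^ 2) ^ k / k.factorial := by
  set g := radialDeriv^[k + 1] v with hg
  have hgc : ContinuousOn g (Ioi 0) := continuousOn_radialDeriv_iterate hv
  set J : ℝ → ℝ := fun s => ∫ t in Ioi s, 2 * t * g t * (s ^ 2 - t ^ 2) ^ k / k.factorial with hJ
  have hbound : ∀ s t : ℝ, 0 < s → s < t → ‖2 * t * g t * (s ^ 2 - t ^ 2) ^ k / k.factorial‖ ≤
      2 / s * ‖t ^ (2 * (k + 1)) * g t‖ := by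
    intro s t hs hst
    have ht : 0 < t := hs.trans hst
    have h1 : |s ^ 2 - t ^ 2| ≤ t ^ 2 := by
      rw [abs_of_nonpos (by nlinarith)]; nlinarith
    have h2 : (1 : ℝ) ≤ k.factorial := by exact_mod_cast Nat.one_le_iff_ne_zero.2 k.factorial_ne_zero
    simp only [Real.norm_eq_abs, abs_div, abs_mul, abs_pow, abs_of_pos ht, Nat.abs_cast, abs_two]
    calc 2 * t * |g t| * |s ^ 2 - t ^ 2| ^ k / k.factorial
        ≤ 2 * t * |g t| * |s ^ 2 - t ^ 2| ^ k := div_le_self (by positivity) h2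
      _ ≤ 2 * t * |g t| * (t ^ 2) ^ k * (t / s) := by
        rw [← mul_one (2 * t * |g t| * |s ^ 2 - t ^ 2| ^ k)]
        have : 1 ≤ t / s := (one_le_div hs).2 hst.le
        gcongr
      _ = _ := by rw [← pow_mul]; field_simp; ring
  have hJint : ∀ s, 0 < s →
      IntegrableOn (fun t => 2 * t * g t * (s ^ 2 - t ^ 2) ^ k / k.factorial) (Ioi s) := by
    intro s hs
    refine Integrable.mono' (((hdecay.mono_set (Ioi_subset_Ioi hs.le)).norm).const_mul (2 / s)) ?_ ?_
    · refine ContinuousOn.aestronglyMeasurable ?_ measurableSet_Ioi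
      have := hgc.mono (Ioi_subset_Ioi hs.le)
      fun_prop
    · filter_upwards [ae_restrict_mem measurableSet_Ioi] with t ht
      exact hbound s t hs ht
  have hJle : ∀ s, 0 < s → |J s| ≤ 2 / s * ∫ t in Ioi 0, ‖t ^ (2 * (k + 1)) * g t‖ := by
    intro s hs
    calc |J s| ≤ ∫ t in Ioi s, 2 / s * ‖t ^ (2 * (k + 1)) * g t‖ := by
          rw [← Real.norm_eq_abs]
          refine norm_integral_le_of_norm_le
            (((hdecay.mono_set (Ioi_subset_Ioi hs.le)).norm).const_mul (2 / s)) ?_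
          filter_upwards [ae_restrict_mem measurableSet_Ioi] with t ht
          exact hbound s t hs ht
      _ ≤ _ := by
          rw [integral_const_mul]
          refine mul_le_mul_of_nonneg_left ?_ (by positivity)
          exact setIntegral_mono_set hdecay.norm (.of_forall fun _ => norm_nonneg _)
            (Ioi_subset_Ioi hs.le).eventuallyLE
  -- Taylor's formula between `s` and `T`, with `T` tending to infinity
  have hlim : ∀ s, 0 < s →
      Tendsto (fun T => (sqTaylor v (k + 1) T).eval (s ^ 2)) atTop (𝓝 (v s + J s)) := by
    intro s hs
    have h1 := intervalIntegral_tendsto_integral_Ioi s (hJint s hs) tendsto_id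
    refine (h1.const_add (v s)).congr' ?_
    filter_upwards [eventually_ge_atTop s] with T hT
    have hpos : ∀ t ∈ uIcc s T, 0 < t := fun t ht => by
      rw [uIcc_of_le hT] at ht; exact hs.trans_le ht.1
    have hgT : ContinuousOn g (uIcc s T) := hgc.mono hpos
    have h2 := intervalIntegral.integral_eq_sub_of_hasDerivAt
      (fun t ht => hasDerivAt_eval_sqTaylor hv (s ^ 2) (hpos t ht) k (by omega))
      (ContinuousOn.intervalIntegrable (by rw [← hg]; fun_prop))
    have h3 : (sqTaylor v (k + 1) s).eval (s ^ 2) = v s := by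
      rw [eval_sqTaylor, Finset.sum_range_succ', Finset.sum_eq_zero]
      · simp
      · intro i _; simp
    rw [h3] at h2
    simp only [id]
    rw [h2]
    ring
  obtain ⟨Q, hQ⟩ := exists_polynomial_of_tendsto (l := atTop) (P := fun T => sqTaylor v (k + 1) T)
    (q := fun σ => v √σ + J √σ) (k + 1) (fun T => degree_sqTaylor_lt v _ T) (fun σ hσ => by
      simpa [Real.sq_sqrt hσ.le] using hlim √σ (Real.sqrt_pos.2 hσ))
  have hQ0 : Q = 0 := by
    by_contra hne
    obtain ⟨c, hc, hev⟩ := exists_eventually_le_abs_eval hne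
    have hJ0 : Tendsto J atTop (𝓝 0) := by
      rw [tendsto_zero_iff_abs_tendsto_zero]
      refine squeeze_zero' (.of_forall fun _ => abs_nonneg _)
        (by filter_upwards [eventually_gt_atTop 0] with s hs using hJle s hs) ?_
      simpa using (tendsto_const_nhds.div_atTop tendsto_id).mul_const
        (∫ t in Ioi 0, ‖t ^ (2 * (k + 1)) * g t‖)
    have hev2 : ∀ᶠ s in atTop, c / 2 ≤ |v s| := by
      have hsq : Tendsto (fun s : ℝ => s ^ 2) atTop atTop := tendsto_pow_atTop two_ne_zero
      filter_upwards [hsq.eventually hev, eventually_gt_atTop 0,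
        (tendsto_zero_iff_abs_tendsto_zero _).1 hJ0 |>.eventually (gt_mem_nhds (half_pos hc))]
        with s h1 h2 h3
      have h4 := hQ (s ^ 2) (by positivity)
      simp only [Real.sqrt_sq h2.le] at h4
      rw [← h4] at h1
      simp only [Function.comp_apply] at h3
      have := abs_add_le (v s) (J s)
      linarith
    obtain ⟨a, ha⟩ := eventually_atTop.1 hev2
    have h5 : IntegrableOn (fun _ : ℝ => c / 2) (Ici a) := by
      refine Integrable.mono' hint.norm.integrableOn aestronglyMeasurable_const ?_
      filter_upwards [ae_restrict_mem measurableSet_Ici] with s hs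
      rw [Real.norm_of_nonneg (by positivity)]
      exact ha s hs
    rw [integrableOn_const_iff] at h5
    rcases h5 with h5 | h5
    · simp [hc.ne'] at h5
    · simp at h5
  have h6 := hQ (s ^ 2) (by positivity)
  simp only [Real.sqrt_sq hs.le, hQ0, Polynomial.eval_zero] at h6
  linarith

end Representation

/-! ### Slicing Euclidean space -/

section Slicing

variable {n : ℕ}

/-- The point of `ℝ^{n+1}` with first coordinate `s` and remaining coordinates `y`. -/
def consE (p : ℝ × E n) : E (n + 1) := WithLp.toLp 2 (Fin.cons p.1 p.2.ofLp)

lemma inner_consE (p q : ℝ × E n) :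
    inner ℝ (consE p) (consE q) = p.1 * q.1 + inner ℝ p.2 q.2 := by
  simp [consE, PiLp.inner_apply, Fin.sum_univ_succ, mul_comm]

lemma norm_consE (p : ℝ × E n) : ‖consE p‖ = √(p.1 ^ 2 + ‖p.2‖ ^ 2) := by
  rw [norm_eq_sqrt_real_inner, inner_consE, real_inner_self_eq_norm_sq, ← sq]

/-- Euclidean space splits as a measurable product of a line and a space of one dimension less. -/
def consEquiv (n : ℕ) : ℝ × E n ≃ᵐ E (n + 1) :=
  ((MeasurableEquiv.refl ℝ).prodCongr (MeasurableEquiv.toLp 2 (Fin n → ℝ)).symm).trans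
    ((MeasurableEquiv.piFinSuccAbove (fun _ : Fin (n + 1) => ℝ) 0).symm.trans
      (MeasurableEquiv.toLp 2 (Fin (n + 1) → ℝ)))

lemma coe_consEquiv : (consEquiv n : ℝ × E n → E (n + 1)) = consE := by
  ext p i
  change (Fin.insertNth 0 p.1 p.2.ofLp : Fin (n + 1) → ℝ) i = _
  rw [Fin.insertNth_zero']
  rfl

lemma measurePreserving_consEquiv :
    MeasurePreserving (consEquiv n) (volume.prod volume) volume := by
  refine ((MeasurePreserving.id volume).prod
    (PiLp.volume_preserving_ofLp (Fin n))).trans ?_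
  exact ((volume_preserving_piFinSuccAbove (fun _ : Fin (n + 1) => ℝ) 0).symm _).trans
    (PiLp.volume_preserving_toLp (Fin (n + 1)))

variable {F : Type*} [NormedAddCommGroup F]

lemma integral_consE [NormedSpace ℝ F] (g : E (n + 1) → F) :
    ∫ p, g (consE p) ∂(volume.prod volume : Measure (ℝ × E n)) = ∫ x, g x := by
  rw [← measurePreserving_consEquiv.integral_comp (consEquiv n).measurableEmbedding, coe_consEquiv]

lemma integrable_consE {g : E (n + 1) → F} :
    Integrable (fun p => g (consE p)) (volume.prod volume : Measure (ℝ × E n)) ↔ Integrable g := by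
  rw [← measurePreserving_consEquiv.integrable_comp_emb (consEquiv n).measurableEmbedding,
    coe_consEquiv]
  rfl

end Slicing

/-! ### The substitution `t² = a² + r²` -/

section Substitution

/-- The substitution `t² = a² + r²`. -/
lemma integral_comp_sqrt_add_sq {a : ℝ} (ha : 0 ≤ a) (φ h : ℝ → ℝ) :
    ∫ r in Ioi 0, φ r * h √(r ^ 2 + a ^ 2) =
      ∫ t in Ioi a, t / √(t ^ 2 - a ^ 2) * (φ √(t ^ 2 - a ^ 2) * h t) := by
  have hpos : ∀ t ∈ Ioi a, 0 < t ^ 2 - a ^ 2 := fun t ht => by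
    have : a < t := ht
    nlinarith
  have himg : (fun t => √(t ^ 2 - a ^ 2)) '' Ioi a = Ioi 0 := by
    ext r
    simp only [mem_image, mem_Ioi]
    constructor
    · rintro ⟨t, ht, rfl⟩
      exact Real.sqrt_pos.2 (hpos t ht)
    · intro hr
      refine ⟨√(r ^ 2 + a ^ 2), Real.lt_sqrt_of_sq_lt (by nlinarith), ?_⟩
      rw [Real.sq_sqrt (by positivity), add_sub_cancel_right, Real.sqrt_sq hr.le]
  have hinj : InjOn (fun t => √(t ^ 2 - a ^ 2)) (Ioi a) := by
    intro t ht t' ht' h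
    have h1 := (Real.sqrt_inj (hpos t ht).le (hpos t' ht').le).1 h
    have h2 : a < t := ht
    have h3 : a < t' := ht'
    exact (sq_eq_sq₀ (by linarith) (by linarith)).1 (by linarith)
  have hder : ∀ t ∈ Ioi a, HasDerivWithinAt (fun t => √(t ^ 2 - a ^ 2)) (t / √(t ^ 2 - a ^ 2))
      (Ioi a) t := by
    intro t ht
    have h1 := ((hasDerivAt_pow 2 t).sub_const (a ^ 2)).sqrt (hpos t ht).ne'
    refine (h1.congr_deriv ?_).hasDerivWithinAt
    have := Real.sqrt_pos.2 (hpos t ht)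
    field_simp
    norm_num
  rw [← himg, integral_image_eq_integral_abs_deriv_smul measurableSet_Ioi hder hinj]
  refine setIntegral_congr_fun measurableSet_Ioi fun t ht => ?_
  have h1 : 0 ≤ t := ha.trans (le_of_lt ht)
  rw [Real.sq_sqrt (hpos t ht).le, sub_add_cancel, Real.sqrt_sq h1, abs_of_nonneg (by positivity),
    smul_eq_mul]

end Substitution

/-! ### Radial functions and hyperplane integrals -/

section Radial

lemma fourier_eq_of_norm_eq {V : Type*} [NormedAddCommGroup V] [InnerProductSpace ℝ V]
    [FiniteDimensional ℝ V] [MeasurableSpace V] [BorelSpace V] (g : ℝ → ℂ) {ξ η : V}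
    (h : ‖ξ‖ = ‖η‖) : 𝓕 (fun x : V => g ‖x‖) ξ = 𝓕 (fun x : V => g ‖x‖) η := by
  have h1 := Real.fourier_comp_linearIsometry ((ℝ ∙ (ξ - η))ᗮ.reflection) (fun x : V => g ‖x‖) ξ
  have h2 : (fun x : V => g ‖x‖) ∘ (ℝ ∙ (ξ - η))ᗮ.reflection = fun x => g ‖x‖ := by
    ext x
    simp
  rwa [Submodule.reflection_sub h, h2] at h1

lemma fourier_real_eq_cosTransform {v : ℝ → ℝ} (hv : Integrable v) (heven : ∀ s, v (-s) = v s)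
    (ρ : ℝ) : ∫ s, (Real.fourierChar (-(ρ * s)) : ℂ) * v s = cosTransform v ρ := by
  have hsin := integral_mul_sin_eq_zero heven ρ
  have e : ∀ s, (Real.fourierChar (-(ρ * s)) : ℂ) * v s =
      ((v s * Real.cos (2 * Real.pi * ρ * s) : ℝ) : ℂ) -
        ((v s * Real.sin (2 * Real.pi * ρ * s) : ℝ) : ℂ) * Complex.I := by
    intro s
    rw [Real.fourierChar_apply, Complex.exp_mul_I, ← Complex.ofReal_cos, ← Complex.ofReal_sin,
      show 2 * Real.pi * -(ρ * s) = -(2 * Real.pi * ρ * s) by ring, Real.cos_neg, Real.sin_neg]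
    push_cast
    ring
  simp only [e]
  have h1 : Integrable fun s => ((v s * Real.cos (2 * Real.pi * ρ * s) : ℝ) : ℂ) :=
    (integrable_mul_of_abs_le_one hv (by fun_prop) fun s => Real.abs_cos_le_one _).ofReal
  have h2 : Integrable fun s => ((v s * Real.sin (2 * Real.pi * ρ * s) : ℝ) : ℂ) :=
    (integrable_mul_of_abs_le_one hv (by fun_prop) fun s => Real.abs_sin_le_one _).ofReal
  rw [integral_sub h1 (h2.mul_const _), integral_mul_const, integral_complex_ofReal,
    integral_complex_ofReal, hsin, cosTransform]
  simp

variable {v : ℝ → ℝ} {k : ℕ}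

/-- Integrals of the odd-dimensional radial function over hyperplanes return the filter. -/
lemma integral_hyperplane (hv : ContDiffOn ℝ (k : ℕ) v (Ioi 0)) (heven : ∀ s, v (-s) = v s)
    (hdecay : IntegrableOn (fun t => t ^ (2 * k) * (radialDeriv^[k] v) t) (Ioi 0))
    (hint : Integrable v) {s : ℝ} (hs : s ≠ 0) :
    ∫ y : E (2 * k), (-1) ^ k / Real.pi ^ k * (radialDeriv^[k] v) √(s ^ 2 + ‖y‖ ^ 2) = v s := by
  have habs : v |s| = v s := by rcases abs_choice s with h | h <;> rw [h]; exact heven s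
  cases k with
  | zero =>
    -- the line: hyperplanes are points, and the volume of `ℝ^0` is the point mass
    have h1 : ∀ y : E (2 * 0), (-1 : ℝ) ^ 0 / Real.pi ^ 0 *
        (radialDeriv^[0] v) √(s ^ 2 + ‖y‖ ^ 2) = v s := by
      intro y
      have : y = 0 := Subsingleton.elim (α := EuclideanSpace ℝ (Fin 0)) y 0
      rw [this]
      simp [Real.sqrt_sq_eq_abs, habs]
    simp only [h1, integral_const, smul_eq_mul]
    have h2 : (volume : Measure (E (2 * 0))).real univ = 1 := by
      have := (EuclideanSpace.volume_preserving_symm_measurableEquiv_toLp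
        (Fin (2 * 0))).measure_preimage (s := univ) MeasurableSet.univ.nullMeasurableSet
      rw [Measure.real, ← preimage_univ, this, volume_pi, Measure.pi_univ,
        Finset.prod_eq_one fun i _ => i.elim0]
      simp
    rw [h2, one_mul]
  | succ k =>
    set g := radialDeriv^[k + 1] v with hg
    have hnt : Nontrivial (E (2 * (k + 1))) := by
      have : Nonempty (Fin (2 * (k + 1))) := ⟨⟨0, by omega⟩⟩
      infer_instance
    have hdim : Module.finrank ℝ (E (2 * (k + 1))) = 2 * (k + 1) := by simp
    have hvol : (volume : Measure (E (2 * (k + 1)))).real (Metric.ball 0 1) =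
        Real.pi ^ (k + 1) / (k + 1).factorial := by
      rw [Measure.real, InnerProductSpace.volume_ball_of_dim_even (k := k + 1) (by simp)]
      simp
      positivity
    have h1 := integral_fun_norm_addHaar (volume : Measure (E (2 * (k + 1))))
      (fun r => (-1) ^ (k + 1) / Real.pi ^ (k + 1) * g √(s ^ 2 + r ^ 2))
    rw [h1, hdim, hvol]
    have hs' : 0 < |s| := abs_pos.2 hs
    have h2 := integral_comp_sqrt_add_sq hs'.le (fun r => r ^ (2 * (k + 1) - 1)) g
    have h3 := eq_neg_integral_radialDeriv hv hdecay hint hs'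
    rw [habs] at h3
    have h4 : ∫ r in Ioi 0, r ^ (2 * (k + 1) - 1) •
        ((-1) ^ (k + 1) / Real.pi ^ (k + 1) * g √(s ^ 2 + r ^ 2)) =
        (-1) ^ (k + 1) / Real.pi ^ (k + 1) *
          ∫ r in Ioi 0, r ^ (2 * (k + 1) - 1) * g √(r ^ 2 + |s| ^ 2) := by
      rw [← integral_const_mul]
      congr 1; ext r
      rw [sq_abs, add_comm (s ^ 2), smul_eq_mul]; ring
    have h5 : ∫ t in Ioi |s|, t / √(t ^ 2 - |s| ^ 2) *
        (√(t ^ 2 - |s| ^ 2) ^ (2 * (k + 1) - 1) * g t) =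
        (-1) ^ k * k.factorial / 2 *
        ∫ t in Ioi |s|, 2 * t * g t * (|s| ^ 2 - t ^ 2) ^ k / k.factorial := by
      rw [← integral_const_mul]
      refine setIntegral_congr_fun measurableSet_Ioi fun t ht => ?_
      have h6 : |s| < t := ht
      have h7 : 0 < t ^ 2 - |s| ^ 2 := by nlinarith
      have h8 : 0 < √(t ^ 2 - |s| ^ 2) := Real.sqrt_pos.2 h7
      have h9 : √(t ^ 2 - |s| ^ 2) ^ (2 * (k + 1) - 1) =
          (t ^ 2 - |s| ^ 2) ^ k * √(t ^ 2 - |s| ^ 2) := by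
        rw [show 2 * (k + 1) - 1 = 2 * k + 1 by omega, pow_succ, pow_mul, Real.sq_sqrt h7.le]
      have h10 : (|s| ^ 2 - t ^ 2) ^ k = (-1) ^ k * (t ^ 2 - |s| ^ 2) ^ k := by
        rw [← mul_pow]; ring
      have h11 : (-1 : ℝ) ^ k * (-1) ^ k = 1 := by rw [← mul_pow]; simp
      have h12 : (k.factorial : ℝ) ≠ 0 := by positivity
      rw [h9, h10]
      field_simp
      linear_combination -(t * g t) * h11
    rw [h4, h2, h5, h3, Nat.factorial_succ]
    have h11 : (-1 : ℝ) ^ k * (-1) ^ k = 1 := by rw [← mul_pow]; simp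
    have h12 : (k.factorial : ℝ) ≠ 0 := by positivity
    have h13 : (Real.pi : ℝ) ≠ 0 := Real.pi_ne_zero
    generalize (∫ t in Ioi |s|, 2 * t * g t * (|s| ^ 2 - t ^ 2) ^ k / k.factorial) = I
    simp only [nsmul_eq_mul, smul_eq_mul]
    push_cast
    rw [pow_succ (-1 : ℝ) k]
    field_simp
    linear_combination -I * h11

end Radial

/-! ### The Fourier transform of `R^♯ v` -/

section RadonSharp

variable {v : ℝ → ℝ} {k : ℕ}

lemma sqrt_pi_pow (k : ℕ) : √(Real.pi ^ (2 * k)) = Real.pi ^ k := by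
  rw [mul_comm, pow_mul, Real.sqrt_sq (by positivity)]

lemma radonSharp_odd (k : ℕ) (v : ℝ → ℝ) (x : E (2 * k + 1)) :
    radonSharp (2 * k + 1) v x = (-1) ^ k / Real.pi ^ k * (radialDeriv^[k] v) ‖x‖ := by
  have h : (2 * k + 1 - 1) / 2 = k := by omega
  rw [radonSharp, if_pos ⟨k, rfl⟩, h, Nat.add_sub_cancel, sqrt_pi_pow]

lemma IsRegularFilter.decay_of {d : ℕ} (hv : IsRegularFilter d v) (hk : d / 2 = k) :
    IntegrableOn (fun t => t ^ (2 * k) * (radialDeriv^[k] v) t) (Ioi 0) := hk ▸ hv.decay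

lemma IsRegularFilter.contDiffOn_of {d : ℕ} (hv : IsRegularFilter d v) (hk : d / 2 = k) :
    ContDiffOn ℝ (k : ℕ) v (Ioi 0) := hk ▸ hv.contDiffOn

lemma integrable_radonSharp_odd (hv : IsRegularFilter (2 * k + 1) v) :
    Integrable (radonSharp (2 * k + 1) v) := by
  have h2 : Integrable (fun x : E (2 * k + 1) => (radialDeriv^[k] v) ‖x‖) := by
    rw [integrable_fun_norm_addHaar]
    simpa using hv.decay_of (k := k) (by omega)
  exact (h2.const_mul ((-1) ^ k / Real.pi ^ k)).congr
    (.of_forall fun x => (radonSharp_odd k v x).symm)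

/-- The Fourier slice theorem in odd dimension: the radial function `R^♯ v` has the Fourier
transform `v̂(‖ξ‖)`. -/
lemma fourier_radonSharp_odd (hv : IsRegularFilter (2 * k + 1) v) (hint : Integrable v)
    (ξ : E (2 * k + 1)) :
    𝓕 (fun x => (radonSharp (2 * k + 1) v x : ℂ)) ξ = cosTransform v ‖ξ‖ := by
  let g : ℝ → ℂ := fun r => (((-1) ^ k / Real.pi ^ k * (radialDeriv^[k] v) r : ℝ) : ℂ)
  have hfun : (fun x => (radonSharp (2 * k + 1) v x : ℂ)) = fun x : E (2 * k + 1) => g ‖x‖ := by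
    ext x
    rw [radonSharp_odd]
  let η : ℝ × E (2 * k) := (‖ξ‖, 0)
  have hη : ‖ξ‖ = ‖consE η‖ := by
    rw [norm_consE]
    simp [η, Real.sqrt_sq]
  rw [hfun, fourier_eq_of_norm_eq g hη, ← hfun]
  have hG : Integrable (fun x => (radonSharp (2 * k + 1) v x : ℂ)) :=
    (integrable_radonSharp_odd hv).ofReal
  have hI := (Real.fourierIntegral_convergent_iff (consE η)).2 hG
  have hI' := integrable_consE.2 hI
  rw [Real.fourier_eq, ← integral_consE, integral_prod _ hI',
    ← fourier_real_eq_cosTransform hint hv.even]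
  refine integral_congr_ae ?_
  have hne : ∀ᵐ s : ℝ, s ≠ 0 := by
    rw [ae_iff]; simp
  filter_upwards [hne] with s hs
  have h1 : ∀ y : E (2 * k), Real.fourierChar (-inner ℝ (consE (s, y)) (consE η)) •
      ((radonSharp (2 * k + 1) v (consE (s, y)) : ℝ) : ℂ) =
      (Real.fourierChar (-(‖ξ‖ * s)) : ℂ) *
        (((-1) ^ k / Real.pi ^ k * (radialDeriv^[k] v) √(s ^ 2 + ‖y‖ ^ 2) : ℝ) : ℂ) := by
    intro y
    rw [inner_consE, radonSharp_odd, norm_consE]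
    simp [η, Circle.smul_def, mul_comm s]
  simp only [h1]
  rw [integral_const_mul, integral_complex_ofReal,
    integral_hyperplane (hv.contDiffOn_of (by omega)) hv.even (hv.decay_of (by omega)) hint hs]

lemma not_odd_two_mul (k : ℕ) : ¬ Odd (2 * k) := by simp

/-- In even dimension `R^♯ v` is the integral over lines of the one for the next odd dimension. -/
lemma radonSharp_even (k : ℕ) (v : ℝ → ℝ) (x : E (2 * k)) :
    radonSharp (2 * k) v x = ∫ s : ℝ, radonSharp (2 * k + 1) v (consE (s, x)) := by
  have hk : 2 * k / 2 = k := by omega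
  have h1 : ∀ s : ℝ, radonSharp (2 * k + 1) v (consE (s, x)) =
      (fun r => 1 * ((-1) ^ k / Real.pi ^ k * (radialDeriv^[k] v) √(r ^ 2 + ‖x‖ ^ 2))) |s| := by
    intro s
    rw [radonSharp_odd, norm_consE]
    simp only [sq_abs, one_mul]
  simp only [h1]
  rw [integral_comp_abs (f := fun r => 1 * ((-1) ^ k / Real.pi ^ k *
      (radialDeriv^[k] v) √(r ^ 2 + ‖x‖ ^ 2))),
    integral_comp_sqrt_add_sq (norm_nonneg x) (fun _ => 1)
      (fun t => (-1) ^ k / Real.pi ^ k * (radialDeriv^[k] v) t), radonSharp,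
    if_neg (not_odd_two_mul k), hk, sqrt_pi_pow, ← integral_const_mul, ← integral_const_mul]
  congr 1; ext t
  ring

lemma IsRegularFilter.succ_of_even (hv : IsRegularFilter (2 * k) v) :
    IsRegularFilter (2 * k + 1) v := by
  have h : (2 * k + 1) / 2 = 2 * k / 2 := by omega
  exact ⟨hv.even, h ▸ hv.contDiffOn, h ▸ hv.decay⟩

lemma integrable_radonSharp_even (hv : IsRegularFilter (2 * k) v) :
    Integrable (radonSharp (2 * k) v) := by
  have h := integrable_consE.2 (integrable_radonSharp_odd hv.succ_of_even)
  exact h.integral_prod_right.congr (.of_forall fun x => (radonSharp_even k v x).symm)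

lemma fourier_radonSharp_even (hv : IsRegularFilter (2 * k) v) (hint : Integrable v)
    (ξ : E (2 * k)) :
    𝓕 (fun x => (radonSharp (2 * k) v x : ℂ)) ξ = cosTransform v ‖ξ‖ := by
  have hη : ‖consE ((0, ξ) : ℝ × E (2 * k))‖ = ‖ξ‖ := by
    rw [norm_consE]
    simp
  have hG : Integrable (fun x => (radonSharp (2 * k + 1) v x : ℂ)) :=
    (integrable_radonSharp_odd hv.succ_of_even).ofReal
  have hI := integrable_consE.2 ((Real.fourierIntegral_convergent_iff (consE (0, ξ))).2 hG)
  rw [← hη, ← fourier_radonSharp_odd hv.succ_of_even hint, Real.fourier_eq, Real.fourier_eq,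
    ← integral_consE, integral_prod_symm _ hI]
  congr 1; ext x
  rw [radonSharp_even, ← integral_complex_ofReal]
  simp only [Circle.smul_def, smul_eq_mul, inner_consE, mul_zero, zero_add]
  rw [integral_const_mul]

lemma integrable_radonSharp {d : ℕ} (hv : IsRegularFilter d v) : Integrable (radonSharp d v) := by
  obtain ⟨k, rfl | rfl⟩ := d.even_or_odd'
  · exact integrable_radonSharp_even hv
  · exact integrable_radonSharp_odd hv

lemma fourier_radonSharp {d : ℕ} (hv : IsRegularFilter d v) (hint : Integrable v) (ξ : E d) :
    𝓕 (fun x => (radonSharp d v x : ℂ)) ξ = cosTransform v ‖ξ‖ := by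
  obtain ⟨k, rfl | rfl⟩ := d.even_or_odd'
  · exact fourier_radonSharp_even hv hint ξ
  · exact fourier_radonSharp_odd hv hint ξ

end RadonSharp

/-! ### Unconditional series in `L²` -/

section Series

variable {V : Type*} [NormedAddCommGroup V] [InnerProductSpace ℝ V] [FiniteDimensional ℝ V]
  [MeasurableSpace V] [BorelSpace V]

lemma norm_toLp_sq {F : V → ℂ} (hF : MemLp F 2) : ‖hF.toLp F‖ ^ 2 = ∫ ξ, ‖F ξ‖ ^ 2 := by
  rw [Lp.norm_toLp, ← ENNReal.toReal_pow, eLpNorm_two_sq hF,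
    ENNReal.toReal_ofReal (integral_nonneg fun _ => by positivity)]

/-- Dominated convergence for unconditional series in `L²`. -/
lemma hasSum_toLp {ι : Type*} [Countable ι] {G : ι → V → ℂ} {S : V → ℂ} {b : V → ℝ}
    (hG : ∀ j, MemLp (G j) 2) (hS : MemLp S 2) (hb : MemLp b 2)
    (hbound : ∀ (s : Finset ι) ξ, ‖∑ j ∈ s, G j ξ - S ξ‖ ≤ b ξ)
    (hsum : ∀ ξ, HasSum (fun j => G j ξ) (S ξ)) :
    HasSum (fun j => (hG j).toLp (G j)) (hS.toLp S) := by
  have hD : ∀ s : Finset ι, MemLp (fun ξ => ∑ j ∈ s, G j ξ - S ξ) 2 := fun s =>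
    (memLp_finsetSum s fun j _ => hG j).sub hS
  have hLp : ∀ s : Finset ι, ∑ j ∈ s, (hG j).toLp (G j) - hS.toLp S = (hD s).toLp _ := by
    intro s
    have h1 : ∑ j ∈ s, (hG j).toLp (G j) =
        (memLp_finsetSum s fun j _ => hG j).toLp (fun ξ => ∑ j ∈ s, G j ξ) := by
      classical
      induction s using Finset.induction_on with
      | empty =>
        simp only [Finset.sum_empty]
        exact (MemLp.toLp_zero (MemLp.zero' (p := 2))).symm
      | insert a s ha ih =>
        simp only [Finset.sum_insert ha]
        rw [ih, ← MemLp.toLp_add]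
        rfl
    rw [h1, ← MemLp.toLp_sub]
    rfl
  have h2 : Tendsto (fun s : Finset ι => ∫ ξ, ‖∑ j ∈ s, G j ξ - S ξ‖ ^ 2) atTop (𝓝 0) := by
    have h3 := tendsto_integral_filter_of_dominated_convergence (μ := (volume : Measure V))
      (l := (atTop : Filter (Finset ι))) (F := fun s ξ => ‖∑ j ∈ s, G j ξ - S ξ‖ ^ 2)
      (f := fun _ => 0) (fun ξ => b ξ ^ 2) (.of_forall fun s => ((hD s).1.norm.pow 2))
      (.of_forall fun s => .of_forall fun ξ => ?_) ?_ (.of_forall fun ξ => ?_)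
    · simpa using h3
    · rw [norm_pow, norm_norm]
      gcongr
      exact hbound s ξ
    · exact (memLp_two_iff_integrable_sq hb.1).1 hb
    · have h4 : Tendsto (fun s : Finset ι => ∑ j ∈ s, G j ξ) atTop (𝓝 (S ξ)) := by
        simpa [HasSum] using hsum ξ
      simpa using ((h4.sub_const (S ξ)).norm.pow 2)
  have h5 : Tendsto (fun s : Finset ι => ∑ j ∈ s, (hG j).toLp (G j)) atTop (𝓝 (hS.toLp S)) := by
    rw [tendsto_iff_norm_sub_tendsto_zero]
    have h6 := h2.sqrt
    rw [Real.sqrt_zero] at h6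
    refine h6.congr fun s => ?_
    rw [hLp, ← norm_toLp_sq (hD s), Real.sqrt_sq (norm_nonneg _)]
  simpa [HasSum] using h5

end Series

/-! ### The decomposition and the compressed sensing equations -/

section Reconstruction

variable {d : ℕ} {u : ℕ → E d → ℝ} {v : ℕ → ℝ → ℝ}

/-- The inverse Fourier integrals of `|û_j|² f̂` sum up to that of `(∑ |û_j|²) f̂` in `L²`. -/
lemma hasSum_fourierInv_symbol (hu : IsConvFrame u) {f : E d → ℝ} (hf : ContDiff ℝ ∞ f)
    (hc : HasCompactSupport f) :
    ∃ (hS : MemLp (𝓕⁻ fun ξ => frameSymbol u ξ * testFourier hf hc ξ) 2 volume)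
      (hG : ∀ j, MemLp (𝓕⁻ fun ξ => ((‖𝓕 (fun x => (u j x : ℂ)) ξ‖ ^ 2 : ℝ) : ℂ) *
        testFourier hf hc ξ) 2 volume),
      HasSum (fun j => (hG j).toLp _) (hS.toLp _) := by
  obtain ⟨B, hB⟩ := hu.exists_sum_le
  obtain ⟨C, hC⟩ := hu.exists_norm_frameSymbol_le
  have hH1 : Integrable (testFourier hf hc) := (testFourier hf hc).integrable
  have hH2 : MemLp (testFourier hf hc) 2 volume := (testFourier hf hc).memLp 2
  have hnn : ∀ j ξ, 0 ≤ ‖𝓕 (fun x => (u j x : ℂ)) ξ‖ ^ 2 := fun _ _ => by positivity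
  have hmul : ∀ {m : E d → ℂ} {K : ℝ}, AEStronglyMeasurable m volume → (∀ ξ, ‖m ξ‖ ≤ K) →
      Integrable (fun ξ => m ξ * testFourier hf hc ξ) ∧
        MemLp (fun ξ => m ξ * testFourier hf hc ξ) 2 volume := fun hm hK =>
    ⟨hH1.bdd_mul hm (.of_forall hK), MemLp.of_le_mul hH2 (hm.mul hH2.1)
      (.of_forall fun ξ => by rw [norm_mul]; gcongr; exact hK ξ)⟩
  have hSm := hmul hu.memLp_frameSymbol.1 hC
  have hGm := fun j => hmul (m := fun ξ => ((‖𝓕 (fun x => (u j x : ℂ)) ξ‖ ^ 2 : ℝ) : ℂ)) (K := B)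
    (Continuous.aestronglyMeasurable (Complex.continuous_ofReal.comp
      ((continuous_fourier (f := fun x => (u j x : ℂ)) (hu.integrable j).ofReal).norm.pow 2)))
    (fun ξ => by
      rw [Complex.norm_real, Real.norm_of_nonneg (hnn j ξ)]
      simpa using hB {j} ξ)
  refine ⟨memLp_two_fourierInv hSm.1 hSm.2, fun j => memLp_two_fourierInv (hGm j).1 (hGm j).2, ?_⟩
  simp only [toLp_fourierInv hSm.1 hSm.2, fun j => toLp_fourierInv (hGm j).1 (hGm j).2]
  have hsum := hasSum_toLp (fun j => (hGm j).2) hSm.2 (hH2.norm.const_mul (B + C))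
    (fun s ξ => by
      rw [← Finset.sum_mul, ← sub_mul, norm_mul]
      gcongr
      refine (norm_sub_le _ _).trans (add_le_add ?_ (hC ξ))
      rw [← Complex.ofReal_sum, Complex.norm_real,
        Real.norm_of_nonneg (Finset.sum_nonneg fun j _ => hnn j ξ)]
      exact hB s ξ)
    (fun ξ => by
      refine HasSum.mul_right _ ?_
      rw [frameSymbol, Complex.hasSum_ofReal]
      exact (hu.summable ξ).hasSum)
  exact hsum.mapL (Lp.fourierTransformₗᵢ (E d) ℂ).symm.toContinuousLinearEquiv.toContinuousLinearMap

/-- Each term of the series is the inverse Fourier integral of `|û_j|² f̂`, because both filters have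
the same real radial Fourier transform. -/
lemma conv_radonSharp_conv {S : Set (E d)} (hS : S.Nonempty) (huv : IsConvFactorization S u v)
    (hv : ∀ j, IsRegularFilter d (v j)) {f : E d → ℝ} (hf : ContDiff ℝ ∞ f)
    (hc : HasCompactSupport f) (j : ℕ) (x : E d) :
    ((conv (radonSharp d (v j)) (conv (u j) f) x : ℝ) : ℂ) =
      𝓕⁻ (fun ξ => ((‖𝓕 (fun x => (u j x : ℂ)) ξ‖ ^ 2 : ℝ) : ℂ) * testFourier hf hc ξ) x := by
  obtain ⟨z, hz⟩ := hS
  have hu := huv.frame_left.integrable j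
  have hvj := huv.frame_right.integrable j
  have hu' : Integrable (fun x => (u j x : ℂ)) := hu.ofReal
  have hH : Integrable (testFourier hf hc) := (testFourier hf hc).integrable
  rw [ofReal_conv (integrable_radonSharp (hv j)) (integrable_fourier_mul hu' hH)
    (ofReal_conv hu hH (ofReal_eq_fourierInv hf hc))]
  refine congrArg (fun F : E d → ℂ => 𝓕⁻ F x) (funext fun ξ => ?_)
  rw [fourier_radonSharp (hv j) hvj, fourier_eq_cosTransform hu hvj (hv j).even z
    fun f hf hc t ht => huv.commute j f hf hc ⟨z, hz⟩ t ht, Complex.norm_real, Real.norm_eq_abs,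
    sq_abs]
  push_cast
  ring

lemma convolutionExists_radonSharp (hu : IsConvFrame u) (hv : ∀ j, IsRegularFilter d (v j))
    {f : E d → ℝ} (hf : ContDiff ℝ ∞ f) (hc : HasCompactSupport f) (j : ℕ) :
    ConvolutionExists (radonSharp d (v j)) (conv (u j) f) (ContinuousLinearMap.mul ℝ ℝ) volume := by
  have hH : Integrable (testFourier hf hc) := (testFourier hf hc).integrable
  have hK := integrable_fourier_mul (r := fun x => (u j x : ℂ)) (hu.integrable j).ofReal hH
  have hconv := ofReal_conv (hu.integrable j) hH (ofReal_eq_fourierInv hf hc)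
  refine convolutionExists_of_bounded (integrable_radonSharp (hv j))
    (continuous_of_eq_fourierInv hK hconv) (fun x => ?_)
    (C := ∫ ξ, ‖𝓕 (fun x => (u j x : ℂ)) ξ * testFourier hf hc ξ‖)
  rw [← Complex.norm_real, hconv]
  exact norm_fourierInv_le _ _

/-- The factors satisfy the compressed sensing equations, by linearity of the temporal
convolution. -/
lemma csForward_conv {S : Set (E d)} (huv : IsConvFactorization S u v) {f : E d → ℝ}
    (hf : ContDiff ℝ ∞ f) (hc : HasCompactSupport f) {m n : ℕ} (A : Matrix (Fin m) (Fin n) ℝ)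
    (z : Fin n → S) (j : ℕ) (i : Fin m) {t : ℝ} (ht : 0 < t) :
    ConvolutionExistsAt (v j) (evenExt (csForward A z f i)) t
      (ContinuousLinearMap.mul ℝ ℝ) volume ∧
    csForward A z (conv (u j) f) i t = timeConv (v j) (csForward A z f i) t := by
  have hvj := huv.frame_right.integrable j
  have hHc : Continuous (testFourier hf hc) := (testFourier hf hc).continuous
  have hHw : ∀ n ≤ 2, Integrable fun ξ => ‖ξ‖ ^ n * ‖testFourier hf hc ξ‖ := fun n _ =>
    integrable_weighted_testFourier hf hc n
  have hh := ofReal_eq_fourierInv hf hc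
  have hex : ∀ l, Integrable fun s => v j s * evenExt (pressure f (z l)) (t - s) := fun l =>
    convolutionExists_of_bounded hvj (continuous_evenExt_pressure hHc hHw hh (z l))
      (abs_evenExt_pressure_le hHc hHw hh (z l)) t
  have hcs : ∀ (g : E d → ℝ) τ, csForward A z g i τ =
      ∑ l, A i l * pressure g (z l) τ := fun g τ => rfl
  have hsum : ∀ s, v j s * evenExt (csForward A z f i) (t - s) =
      ∑ l, A i l * (v j s * evenExt (pressure f (z l)) (t - s)) := by
    intro s
    simp only [evenExt, hcs, Finset.mul_sum]
    exact Finset.sum_congr rfl fun l _ => by ring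
  constructor
  · have : Integrable fun s => v j s * evenExt (csForward A z f i) (t - s) := by
      simp only [hsum]
      exact integrable_finsetSum _ fun l _ => (hex l).const_mul _
    exact this
  · have h1 : timeConv (v j) (csForward A z f i) t =
        ∫ s, v j s * evenExt (csForward A z f i) (t - s) := rfl
    have h2 : ∀ l, timeConv (v j) (pressure f (z l)) t =
        ∫ s, v j s * evenExt (pressure f (z l)) (t - s) := fun l => rfl
    rw [h1, hcs]
    simp only [hsum]
    rw [integral_finsetSum _ fun l _ => (hex l).const_mul _]
    refine Finset.sum_congr rfl fun l _ => ?_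
    rw [integral_const_mul, ← h2]
    congr 1
    exact huv.commute j f hf hc (z l) t ht

end Reconstruction

end CSPAT

theorem proposition4p3 (d : ℕ) (hd : 1 ≤ d) (S : Set (CSPAT.E d)) (hS : S.Nonempty)
    (u : ℕ → CSPAT.E d → ℝ) (v : ℕ → ℝ → ℝ)
    (huv : CSPAT.IsMultiscaleFactorization S u v)
    (hv : ∀ j, CSPAT.IsRegularFilter d (v j)) :
    MemLp (CSPAT.frameSymbol u) ∞ volume ∧
    ∀ (f : CSPAT.E d → ℝ) (hf : ContDiff ℝ ∞ f) (hc : HasCompactSupport f),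
      -- the series for `Φ ⊛ f`, unconditionally convergent in `L²`
      ((∀ j, ConvolutionExists (CSPAT.radonSharp d (v j)) (CSPAT.conv (u j) f)
          (ContinuousLinearMap.mul ℝ ℝ) volume) ∧
        ∃ (hΦ : MemLp (CSPAT.distConv (CSPAT.frameKernel u) hf hc) 2 volume)
          (hj : ∀ j, MemLp (fun x => ((CSPAT.conv (CSPAT.radonSharp d (v j))
            (CSPAT.conv (u j) f) x : ℝ) : ℂ)) 2 volume),
          HasSum (fun j => (hj j).toLp _) (hΦ.toLp _)) ∧
      -- the equations for the factors from compressed sensing data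
      ∀ (m n : ℕ) (A : Matrix (Fin m) (Fin n) ℝ) (z : Fin n → S) (j : ℕ) (i : Fin m) (t : ℝ),
        0 < t →
        ConvolutionExistsAt (v j) (CSPAT.evenExt (CSPAT.csForward A z f i)) t
          (ContinuousLinearMap.mul ℝ ℝ) volume ∧
        CSPAT.csForward A z (CSPAT.conv (u j) f) i t =
          CSPAT.timeConv (v j) (CSPAT.csForward A z f i) t := by
  have hF := huv.factorization
  have hu := hF.frame_left
  refine ⟨hu.memLp_frameSymbol, fun f hf hc => ⟨⟨fun j =>
    CSPAT.convolutionExists_radonSharp hu hv hf hc j, ?_⟩, fun m n A z j i t ht =>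
    CSPAT.csForward_conv hF hf hc A z j i ht⟩⟩
  have h1 : CSPAT.distConv (CSPAT.frameKernel u) hf hc = _ :=
    funext (CSPAT.distConv_frameKernel hu hf hc)
  have h2 := fun j => funext (CSPAT.conv_radonSharp_conv hS hF hv hf hc j)
  simp only [h1, h2]
  exact CSPAT.hasSum_fourierInv_symbol hu hf hc
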